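/- **Setting.** Let $N$ players have compact convex action sets $\mathcal X_i\subset\mathbb R^{n_i}$ ($n_i\ge 1$) with nonempty interior; put $\mathcal X=\prod_i\mathcal X_i$, $n=\sum_i n_i$, and let $\|\cdot\|$ be the Euclidean norm. The payoffs $u_i:\mathcal X\to\mathbb R$ are continuous, $u_i(x_i;x_{-i})$ is concave and continuously differentiable in $x_i$, and $v_i(x)=\nabla_i u_i(x)$ is Lipschitz on $\mathcal X$. For some $\beta>0$ and weights $\lambda_i>0$ the game is $\beta$-strongly monotone: $\sum_i\lambda_i\langle x_i'-x_i,\,v_i(x')-v_i(x)\rangle\le-\beta\|x-x'\|^2$ for all $x,x'\in\mathcal X$. Moreover $|u_i(x)|\le L$ for all $i$ and $x\in\mathcal X$. For each $i$ let $R_i:\operatorname{int}(\mathcal X_i)\to\mathbb R$ be a $\nu_i$-self-concordant barrier: $R_i$ is convex and $C^3$, $R_i(x)\to\infty$ as $x\to\partial\mathcal X_i$, and for all $x\in\operatorname{int}(\mathcal X_i)$, $h\in\mathbb R^{n_i}$, $$|\nabla^3R_i(x)[h,h,h]|\le 2\,(h^\top\nabla^2R_i(x)h)^{3/2},\qquad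 |\nabla R_i(x)^\top h|\le\sqrt{\nu_i}\,(h^\top\nabla^2R_i(x)h)^{1/2}.$$ Write $D_{R_i}(x',x)=R_i(x')-R_i(x)-\langle\nabla R_i(x),x'-x\rangle$. **Algorithm (exact bandit feedback).** Put $\eta_t=\frac1{2nL\sqrt t}$ and $x_i^1=\operatorname{argmin}_{\operatorname{int}(\mathcal X_i)}R_i$. In round $t=1,2,\dots$ every player $i$ sets $A_i^t=\big(\nabla^2R_i(x_i^t)+\tfrac{\eta_t\beta(t+1)}{\lambda_i}I\big)^{-1/2}$, draws $z_i^t$ uniformly from the unit sphere of $\mathbb R^{n_i}$ (independently over $i$ and $t$), plays $\hat x_i^t=x_i^t+A_i^tz_i^t$, receives $u_i(\hat x^t)$, sets $\hat v_i^t=n_i\,u_i(\hat x^t)\,(A_i^t)^{-1}z_i^t$, and updates $$x_i^{t+1}=\operatorname*{argmin}_{x'\in\operatorname{int}(\mathcal X_i)}\ \eta_t\langle\hat v_i^t,x_i^t-x'\rangle+\tfrac{\eta_t\beta(t+1)}{2\lambda_i}\|x_i^t-x'\|^2+D_{R_i}(x',x_i^t).$$ **Theorem.** Let $x^\star\in\mathcal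 X$ be a (pure) Nash equilibrium, i.e. $u_i(x_i;x^\star_{-i})\le u_i(x^\star)$ for all $i$ and $x_i\in\mathcal X_i$. Then $x^\star$ is the only Nash equilibrium, and $$\mathbb E\Big[\sum_{i=1}^N\|\hat x_i^T-x_i^\star\|^2\Big]=\tilde O\Big(\frac1{\sqrt T}\Big),$$ that is, there are constants $C$ and $k\in\mathbb N$, not depending on $T$, such that the left-hand side is at most $C(\log T)^k/\sqrt T$ for all $T\ge2$. -/

import Mathlib

open MeasureTheory ProbabilityTheory

noncomputable section

namespace BanditGame

/-- `ℝⁿ` with its Euclidean norm and inner product. -/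
abbrev E (n : ℕ) : Type := EuclideanSpace ℝ (Fin n)

/-- Joint actions `x = (x_1, …, x_N)`, with `x_i ∈ ℝ^{d i}`. -/
abbrev Profile {N : ℕ} (d : Fin N → ℕ) : Type := (i : Fin N) → E (d i)

/-- The squared Euclidean distance `∑ i, ‖x_i - y_i‖²` of two joint actions. -/
def sqDist {N : ℕ} {d : Fin N → ℕ} (x y : Profile d) : ℝ := ∑ i, ‖x i - y i‖ ^ 2

/-- The individual payoff gradient `v_i(x) = ∇_i u_i(x_i; x_{-i})`, the derivative being taken
within the action set `X i` (so that it makes sense at boundary points too). -/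
def payoffGrad {N : ℕ} {d : Fin N → ℕ} (X : (i : Fin N) → Set (E (d i)))
    (u : Fin N → Profile d → ℝ) (i : Fin N) (x : Profile d) : E (d i) :=
  gradientWithin (fun y => u i (Function.update x i y)) (X i) (x i)

/-- A smooth concave game with `N` players; the payoffs matter only on the product of the
action sets. -/
structure SmoothConcaveGame (N : ℕ) (d : Fin N → ℕ) where
  /-- action sets -/
  X : (i : Fin N) → Set (E (d i))
  /-- payoff functions -/
  u : Fin N → Profile d → ℝ
  convex_X : ∀ i, Convex ℝ (X i)
  compact_X : ∀ i, IsCompact (X i)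
  continuousOn_u : ∀ i, ContinuousOn (u i) (Set.univ.pi X)
  concaveOn_u : ∀ i, ∀ x ∈ Set.univ.pi X,
    ConcaveOn ℝ (X i) (fun y => u i (Function.update x i y))
  differentiableOn_u : ∀ i, ∀ x ∈ Set.univ.pi X,
    DifferentiableOn ℝ (fun y => u i (Function.update x i y)) (X i)
  lipschitz_grad : ∀ i, ∃ ℓ : ℝ, ∀ x ∈ Set.univ.pi X, ∀ x' ∈ Set.univ.pi X,
    ‖payoffGrad X u i x - payoffGrad X u i x'‖ ≤ ℓ * √(sqDist x x')

namespace SmoothConcaveGame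

variable {N : ℕ} {d : Fin N → ℕ}

/-- The set of joint actions. -/
def actions (G : SmoothConcaveGame N d) : Set (Profile d) := Set.univ.pi G.X

/-- The individual payoff gradient of player `i`. -/
def v (G : SmoothConcaveGame N d) (i : Fin N) (x : Profile d) : E (d i) :=
  payoffGrad G.X G.u i x

/-- Pure-strategy Nash equilibria. -/
def IsNash (G : SmoothConcaveGame N d) (x : Profile d) : Prop :=
  x ∈ G.actions ∧ ∀ i, ∀ y ∈ G.X i, G.u i (Function.update x i y) ≤ G.u i x

/-- The game is `β`-strongly monotone, with weights `lam i`. -/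
def IsStronglyMonotone (G : SmoothConcaveGame N d) (lam : Fin N → ℝ) (β : ℝ) : Prop :=
  0 < β ∧ (∀ i, 0 < lam i) ∧ ∀ x ∈ G.actions, ∀ x' ∈ G.actions,
    ∑ i, lam i * inner ℝ (x' i - x i) (G.v i x' - G.v i x) ≤ -β * sqDist x x'

end SmoothConcaveGame

/-- `R` (of which only the restriction to `interior X` matters) is a `ν`-self-concordant barrier
for `X`. -/
structure IsSelfConcordantBarrier {n : ℕ} (X : Set (E n)) (ν : ℝ) (R : E n → ℝ) : Prop where
  contDiffOn : ContDiffOn ℝ 3 R (interior X)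
  convexOn : ConvexOn ℝ (interior X) R
  tendsto_atTop : ∀ b ∈ frontier X,
    Filter.Tendsto R (nhdsWithin b (interior X)) Filter.atTop
  third_le : ∀ x ∈ interior X, ∀ h : E n,
    |iteratedFDeriv ℝ 3 R x ![h, h, h]| ≤ 2 * (iteratedFDeriv ℝ 2 R x ![h, h]) ^ (3 / 2 : ℝ)
  first_le : ∀ x ∈ interior X, ∀ h : E n,
    |inner ℝ (gradient R x) h| ≤ √ν * √(iteratedFDeriv ℝ 2 R x ![h, h])

/-- The Hessian matrix of `R` at `x`. -/
def hessian {n : ℕ} (R : E n → ℝ) (x : E n) : Matrix (Fin n) (Fin n) ℝ :=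
  Matrix.of fun j k =>
    iteratedFDeriv ℝ 2 R x ![EuclideanSpace.single j 1, EuclideanSpace.single k 1]

/-- The scaling matrix `(∇²R(x) + c I)^{-1/2}`, the power being that of the functional calculus
of symmetric matrices. -/
def scaling {n : ℕ} (R : E n → ℝ) (c : ℝ) (x : E n) : Matrix (Fin n) (Fin n) ℝ :=
  cfc (fun s : ℝ => s ^ (-(1 / 2) : ℝ)) (hessian R x + c • (1 : Matrix (Fin n) (Fin n) ℝ))

/-- The Bregman divergence `D_R(x', x)`. -/
def bregman {n : ℕ} (R : E n → ℝ) (x' x : E n) : ℝ :=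
  R x' - R x - inner ℝ (gradient R x) (x' - x)

/-- A minimizer of `f` over `s` (an arbitrary point if there is none). -/
def argminOn {n : ℕ} (s : Set (E n)) (f : E n → ℝ) : E n :=
  Classical.epsilon fun x => x ∈ s ∧ ∀ y ∈ s, f x ≤ f y

/-- The prox-mapping with step size `η` and quadratic coefficient `c`; a barrier is infinite off
`interior X`, so that the minimum over `X` is the one over `interior X`. -/
def prox {n : ℕ} (X : Set (E n)) (R : E n → ℝ) (η c : ℝ) (x vhat : E n) : E n :=
  argminOn (interior X) fun x' =>
    η * inner ℝ vhat (x - x') + c / 2 * ‖x - x'‖ ^ 2 + bregman R x' x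

/-- The uniform probability distribution on the unit sphere of `ℝⁿ` (for `n ≥ 1`). -/
def sphereUniform (n : ℕ) : Measure (Metric.sphere (0 : E n) 1) :=
  ((volume : Measure (E n)).toSphere Set.univ)⁻¹ • (volume : Measure (E n)).toSphere

/-! ### The multi-agent eager self-concordant barrier bandit learning algorithm

`η t` are the step sizes, `lam i` the weights, `β` the module, `R i` the barriers and `z t i` the
perturbation direction of player `i` in round `t`. Rounds are numbered `t = 1, 2, …`. -/

section Algorithm

variable {N : ℕ} {d : Fin N → ℕ} (G : SmoothConcaveGame N d) (R : (i : Fin N) → E (d i) → ℝ)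
  (lam : Fin N → ℝ) (β : ℝ) (η : ℕ → ℝ)

/-- The coefficient `η_t β (t+1) / λ_i`. -/
def coeff (t : ℕ) (i : Fin N) : ℝ := η t * β * (t + 1) / lam i

/-- The scaling matrix `A_i^t` for the pivot `x = x^t`. -/
def scalingAt (t : ℕ) (x : Profile d) (i : Fin N) : Matrix (Fin (d i)) (Fin (d i)) ℝ :=
  scaling (R i) (coeff lam β η t i) (x i)

/-- The joint action `x̂^t` played in round `t`, for the pivot `x = x^t` and the
directions `z = z^t`. -/
def play (t : ℕ) (x z : Profile d) : Profile d := fun i =>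
  x i + Matrix.toEuclideanLin (scalingAt R lam β η t x i) (z i)

/-- The gradient estimate `v̂_i^t = n_i u_i(x̂^t) (A_i^t)⁻¹ z_i^t`, from exact bandit feedback. -/
def gradEst (t : ℕ) (x z : Profile d) (i : Fin N) : E (d i) :=
  (d i * G.u i (play R lam β η t x z)) •
    Matrix.toEuclideanLin (scalingAt R lam β η t x i)⁻¹ (z i)

/-- The pivot `x^t` of round `t` (the value at `t = 0` is a placeholder). -/
def pivot (z : ℕ → Profile d) : ℕ → Profile d
  | 0 => fun i => argminOn (interior (G.X i)) (R i)
  | 1 => fun i => argminOn (interior (G.X i)) (R i)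
  | t + 2 => fun i =>
      prox (G.X i) (R i) (η (t + 1)) (coeff lam β η (t + 1) i) (pivot z (t + 1) i)
        (gradEst G R lam β η (t + 1) (pivot z (t + 1)) (z (t + 1)) i)

/-- The joint action `x̂^t` played in round `t` of the algorithm. -/
def played (z : ℕ → Profile d) (t : ℕ) : Profile d :=
  play R lam β η t (pivot G R lam β η z t) (z t)

end Algorithm

/-- The step sizes `η_t = 1 / (2 n L √t)`, where `n = ∑ i, d i`. -/
def stepSize {N : ℕ} (d : Fin N → ℕ) (L : ℝ) (t : ℕ) : ℝ :=
  1 / (2 * (∑ i, d i : ℕ) * L * √t)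

end BanditGame

end

/-! Uniqueness: a Nash equilibrium satisfies the variational inequality `⟨v_i(x⋆), y - x⋆_i⟩ ≤ 0`.
Testing two equilibria against each other contradicts strong monotonicity unless they coincide.

Rate: fix the horizon `T` and a comparator `p` on the segment from the first pivot to `x⋆`, at
distance `O(1/T)` from `x⋆`. The proof follows the expected potential `V_t = E[∑ λ_i D_{R_i}(p_i,
x_i^t)] + (η_t β t / 2) E‖x^t - p‖²`.

Mirror step (`prox_descent`). Write `c` for the coefficient of the quadratic term. Self-concordance
makes the inverse local norm 1-Lipschitz along a line, so the regularized Bregman divergence is at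
least `r - log(1 + r)`, where `r² = hᵀ(∇²R + cI)h = ‖A⁻¹h‖²`. In this norm `η v̂_i` has dual norm at
most `l = η d_i L ≤ 1/2`, and the step costs at most `2l²`, which is `O(1/t)`.

Bias (`abs_integral_inner_gradEst_sub_le`). To test `v̂_i` against `h`, put `q = A⁻¹h` and average
over the reflection of `z_i` in the hyperplane orthogonal to `q`. The two plays differ by a multiple
of `h`, so the symmetrized estimate is a difference quotient of `u_i` along `h`. The Lipschitz
gradient and `E⟨z, q⟩² = ‖q‖²/d_i` then give a bias of at most `ℓ √(∑ 1/c_j) ‖h‖`. No smoothed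
payoff is needed.

Drift. Strong monotonicity gives `-β‖x - p‖²`. Young's inequality spends half of it on the bias. The
other half, times `η_t`, lowers the time weight from `η_t β (t+1)/2` to `η_t β t/2`, and since `η`
decreases, `V_{t+1} ≤ V_t + O(1/T) + O(1/t)`.

Conclusion. The barrier grows only logarithmically along a segment (`sub_le_log`), so `V_1 = O(log
T)` and hence `V_T = O(log T)`. As `η_T T` is a multiple of `√T`, the mean squared distance of the
pivot from `p` is `O(log T / √T)`. The perturbation satisfies `‖A z‖² ≤ 1/c`, which is `O(1/√T)`,
and the comparator error is smaller still.

The probabilistic bookkeeping rests on compactness: every map of a round is continuous, and in each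
round the pivots stay in a fixed compact subset of the interior. This yields measurability,
boundedness and Fubini. -/

noncomputable section

namespace BanditGame

section OneDim

/-! ### One-dimensional calculus -/

/-- Along a line, a positive second derivative `ψ` with `|ψ'| ≤ 2 ψ^{3/2}` has a
`1`-Lipschitz inverse square root. -/
theorem abs_inv_sqrt_sub_le {ψ ψ' : ℝ → ℝ} {b : ℝ}
    (hψ : ∀ s ∈ Set.Icc 0 b, HasDerivAt ψ (ψ' s) s) (hpos : ∀ s ∈ Set.Icc 0 b, 0 < ψ s)
    (hbd : ∀ s ∈ Set.Icc 0 b, |ψ' s| ≤ 2 * ψ s ^ (3 / 2 : ℝ)) :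
    ∀ s ∈ Set.Icc 0 b, |(√(ψ s))⁻¹ - (√(ψ 0))⁻¹| ≤ s := by
  intro s hs
  have h0 : (0 : ℝ) ∈ Set.Icc 0 b := ⟨le_rfl, hs.1.trans hs.2⟩
  have key := (convex_Icc 0 b).norm_image_sub_le_of_norm_hasDerivWithin_le
    (f := fun s => (√(ψ s))⁻¹)
    (f' := fun s => -(ψ' s / (2 * √(ψ s))) / √(ψ s) ^ 2) (C := 1)
    (fun t ht => (((hψ t ht).sqrt (hpos t ht).ne').inv
      (Real.sqrt_pos.2 (hpos t ht)).ne').hasDerivWithinAt) ?_ h0 hs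
  · simpa [abs_of_nonneg hs.1] using key
  · intro t ht
    have hp := hpos t ht
    have hs' := Real.sqrt_pos.2 hp
    have h32 : ψ t ^ (3 / 2 : ℝ) = √(ψ t) ^ 3 := by
      rw [Real.sqrt_eq_rpow, ← Real.rpow_natCast, ← Real.rpow_mul hp.le]; norm_num
    have hb := hbd t ht
    rw [h32] at hb
    rw [Real.norm_eq_abs, abs_div, abs_neg, abs_div, abs_of_pos (by positivity : 0 < 2 * √(ψ t)),
      abs_of_pos (by positivity : 0 < √(ψ t) ^ 2), div_div, div_le_one (by positivity)]
    nlinarith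

/-- A function with second derivative at least that of `t - log (1 + t)` lies above it. -/
theorem sub_log_le_of_second_deriv {φ φ' ψ : ℝ → ℝ} {r : ℝ} (hr : 0 ≤ r)
    (hφ : ∀ s ∈ Set.Icc (0 : ℝ) 1, HasDerivAt φ (φ' s) s)
    (hφ' : ∀ s ∈ Set.Icc (0 : ℝ) 1, HasDerivAt φ' (ψ s) s)
    (hψ : ∀ s ∈ Set.Icc (0 : ℝ) 1, (r / (1 + r * s)) ^ 2 ≤ ψ s) :
    r - Real.log (1 + r) ≤ φ 1 - φ 0 - φ' 0 := by
  have hpos : ∀ s ∈ Set.Icc (0 : ℝ) 1, 0 < 1 + r * s := fun s hs => by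
    have := mul_nonneg hr hs.1; linarith
  have hlin : ∀ s : ℝ, HasDerivAt (fun s => 1 + r * s) r s := fun s => by
    simpa using ((hasDerivAt_id s).const_mul r).const_add 1
  have hd1 : ∀ s ∈ Set.Icc (0 : ℝ) 1,
      HasDerivAt (fun s => φ' s - φ' 0 - (r - r / (1 + r * s)))
        (ψ s - (r / (1 + r * s)) ^ 2) s := fun s hs => by
    have h1 := ((hlin s).inv (hpos s hs).ne').const_mul r
    have h2 := ((hφ' s hs).sub_const (φ' 0)).sub (h1.const_sub r)
    have := (hpos s hs).ne'
    convert! h2 using 1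
    field_simp
  have hmono1 : MonotoneOn (fun s => φ' s - φ' 0 - (r - r / (1 + r * s))) (Set.Icc 0 1) :=
    monotoneOn_of_hasDerivWithinAt_nonneg (convex_Icc 0 1)
      (fun s hs => (hd1 s hs).continuousAt.continuousWithinAt)
      (fun s hs => (hd1 s (interior_subset hs)).hasDerivWithinAt)
      (fun s hs => by have := hψ s (interior_subset hs); linarith)
  have hd0 : ∀ s ∈ Set.Icc (0 : ℝ) 1,
      HasDerivAt (fun s => φ s - φ' 0 * s - (r * s - Real.log (1 + r * s)))
        (φ' s - φ' 0 - (r - r / (1 + r * s))) s := fun s hs => by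
    have h1 := (hlin s).log (hpos s hs).ne'
    have h2 := ((hφ s hs).sub ((hasDerivAt_id s).const_mul (φ' 0))).sub
      (((hasDerivAt_id s).const_mul r).sub h1)
    convert! h2 using 1
    simp
  have hmono0 : MonotoneOn (fun s => φ s - φ' 0 * s - (r * s - Real.log (1 + r * s)))
      (Set.Icc 0 1) :=
    monotoneOn_of_hasDerivWithinAt_nonneg (convex_Icc 0 1)
      (fun s hs => (hd0 s hs).continuousAt.continuousWithinAt)
      (fun s hs => (hd0 s (interior_subset hs)).hasDerivWithinAt)
      (fun s hs => by
        have := hmono1 (by simp) (interior_subset hs) (interior_subset hs).1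
        simpa using this)
  have := hmono0 (by simp : (0 : ℝ) ∈ Set.Icc (0 : ℝ) 1) (by simp : (1 : ℝ) ∈ Set.Icc (0 : ℝ) 1)
    zero_le_one
  simp at this
  linarith

/-- The supremum over `r` is `-l - log (1 - l)`, attained at `1 + r = (1 - l)⁻¹`. The tangent bound
`log y ≤ y - 1`, used twice, gives the estimate without any maximization. -/
theorem mul_sub_add_log_le {l r : ℝ} (hl : l ≤ 1 / 2) (hr : 0 ≤ r) :
    l * r - (r - Real.log (1 + r)) ≤ 2 * l ^ 2 := by
  have h1 : Real.log ((1 - l) * (1 + r)) ≤ (1 - l) * (1 + r) - 1 :=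
    Real.log_le_sub_one_of_pos (by nlinarith)
  have h2 : Real.log (1 - l)⁻¹ ≤ (1 - l)⁻¹ - 1 :=
    Real.log_le_sub_one_of_pos (inv_pos.2 (by linarith))
  rw [Real.log_mul (by linarith) (by linarith)] at h1
  rw [Real.log_inv] at h2
  have h3 : (1 - l)⁻¹ ≤ 1 + l + 2 * l ^ 2 := by
    rw [inv_le_iff_one_le_mul₀ (by linarith)]
    nlinarith [sq_nonneg l, mul_nonneg (sq_nonneg l) (by linarith : 0 ≤ 1 - 2 * l)]
  linarith

/-- If `φ'^2 ≤ ν φ''` on `[0, 1)`, then `φ` grows at most like `-ν log (1 - s)`. -/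
theorem sub_le_log_of_sq_deriv_le {φ φ' ψ : ℝ → ℝ} {ν : ℝ} (hν : 0 < ν)
    (hφ : ∀ s ∈ Set.Ico (0 : ℝ) 1, HasDerivAt φ (φ' s) s)
    (hφ' : ∀ s ∈ Set.Ico (0 : ℝ) 1, HasDerivAt φ' (ψ s) s)
    (hle : ∀ s ∈ Set.Ico (0 : ℝ) 1, φ' s ^ 2 ≤ ν * ψ s) {s : ℝ} (hs : s ∈ Set.Ico (0 : ℝ) 1) :
    φ s - φ 0 ≤ -ν * Real.log (1 - s) := by
  have hψ0 : ∀ t ∈ Set.Ico (0 : ℝ) 1, 0 ≤ ψ t := fun t ht => by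
    have := hle t ht
    by_contra hc
    nlinarith [sq_nonneg (φ' t)]
  have hmono : MonotoneOn φ' (Set.Ico 0 1) :=
    monotoneOn_of_hasDerivWithinAt_nonneg (convex_Ico 0 1)
      (fun s hs => (hφ' s hs).continuousAt.continuousWithinAt)
      (fun s hs => (hφ' s (interior_subset hs)).hasDerivWithinAt)
      (fun s hs => hψ0 s (interior_subset hs))
  -- If `φ' t` were larger, then since `(-1/φ')' ≥ 1/ν` the quantity `1/φ'` would fall to zero no
  -- later than `t + ν / φ' t < 1`, although `φ'` is finite and positive there.
  have hder : ∀ t ∈ Set.Ico (0 : ℝ) 1, φ' t ≤ ν / (1 - t) := by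
    intro t ht
    by_contra! hc
    have h1t : 0 < 1 - t := by linarith [ht.2]
    have hφt : 0 < φ' t := lt_trans (by positivity) hc
    have hsub : Set.Ico t 1 ⊆ Set.Ico 0 1 := Set.Ico_subset_Ico_left ht.1
    have hp : ∀ q ∈ Set.Ico t 1, 0 < φ' q := fun q hq =>
      hφt.trans_le (hmono ht (hsub hq) hq.1)
    have hm : MonotoneOn (fun q => -(φ' q)⁻¹ - q / ν) (Set.Ico t 1) := by
      have hd : ∀ q ∈ Set.Ico t 1, HasDerivAt (fun q => -(φ' q)⁻¹ - q / ν)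
          (-(-(ψ q) / φ' q ^ 2) - 1 / ν) q := fun q hq =>
        ((hφ' q (hsub hq)).inv (hp q hq).ne').neg.sub ((hasDerivAt_id q).div_const ν)
      refine monotoneOn_of_hasDerivWithinAt_nonneg (convex_Ico t 1)
        (fun s hs => (hd s hs).continuousAt.continuousWithinAt)
        (fun s hs => (hd s (interior_subset hs)).hasDerivWithinAt) (fun q hq => ?_)
      have hq' := interior_subset hq
      have := hle q (hsub hq')
      have hpq := hp q hq'
      rw [neg_div, neg_neg, sub_nonneg, div_le_div_iff₀ hν (by positivity)]
      linarith
    have hlt : ν / φ' t < 1 - t := by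
      rw [div_lt_iff₀ hφt]; rw [div_lt_iff₀ h1t] at hc; linarith
    have hνφ : 0 < ν / φ' t := by positivity
    have hq : t + ν / φ' t ∈ Set.Ico t 1 := ⟨by linarith, by linarith⟩
    have := hm ⟨le_rfl, ht.2⟩ hq hq.1
    have hpq := inv_pos.2 (hp _ hq)
    have e : (t + ν / φ' t) / ν = t / ν + (φ' t)⁻¹ := by field_simp
    simp only [e] at this
    linarith
  have hd : ∀ t ∈ Set.Ico (0 : ℝ) 1,
      HasDerivAt (fun t => -ν * Real.log (1 - t) - φ t) (ν / (1 - t) - φ' t) t := fun t ht => by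
    have h1t : 1 - t ≠ 0 := by linarith [ht.2]
    have h := ((((hasDerivAt_id t).const_sub 1).log h1t).const_mul (-ν)).sub (hφ t ht)
    convert! h using 1
    simp only [id]
    ring
  have hm := monotoneOn_of_hasDerivWithinAt_nonneg (convex_Ico (0 : ℝ) 1)
    (fun s hs => (hd s hs).continuousAt.continuousWithinAt)
    (fun s hs => (hd s (interior_subset hs)).hasDerivWithinAt)
    (fun s hs => sub_nonneg.2 (hder s (interior_subset hs)))
  have := hm ⟨le_rfl, zero_lt_one⟩ hs hs.1
  simp at this
  linarith

end OneDim

section Barrier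

/-! ### Self-concordant barriers -/

theorem hasDerivAt_iteratedFDeriv_line {n k : ℕ} {m : ℕ∞} (hk : (k : ℕ∞) < m)
    {f : E n → ℝ} {x h : E n} {s : ℝ}
    (hf : ContDiffAt ℝ m f (x + s • h)) :
    HasDerivAt (fun s : ℝ => iteratedFDeriv ℝ k f (x + s • h) (fun _ => h))
      (iteratedFDeriv ℝ (k + 1) f (x + s • h) (fun _ => h)) s := by
  have h1 : HasDerivAt (fun s : ℝ => x + s • h) h s := by
    simpa using ((hasDerivAt_id s).smul_const h).const_add x
  have h2 := (hf.differentiableAt_iteratedFDeriv (by exact_mod_cast hk)).hasFDerivAt.comp_hasDerivAt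
    s h1
  have h3 := (ContinuousMultilinearMap.apply ℝ (fun _ : Fin k => E n) ℝ
    (fun _ => h)).hasFDerivAt.comp_hasDerivAt s h2
  exact h3

/-- The quadratic form `h ↦ hᵀ ∇²R(x) h`. -/
def hessForm {n : ℕ} (R : E n → ℝ) (x h : E n) : ℝ := iteratedFDeriv ℝ 2 R x ![h, h]

theorem hessForm_eq {n : ℕ} (R : E n → ℝ) (x h : E n) :
    hessForm R x h = iteratedFDeriv ℝ 2 R x (fun _ => h) := by
  unfold hessForm; congr 1; ext i; fin_cases i <;> rfl

namespace IsSelfConcordantBarrier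

variable {n : ℕ} {X : Set (E n)} {ν : ℝ} {R : E n → ℝ}

theorem contDiffAt (hb : IsSelfConcordantBarrier X ν R) {x : E n} (hx : x ∈ interior X) :
    ContDiffAt ℝ ((3 : ℕ∞) : WithTop ℕ∞) R x :=
  hb.contDiffOn.contDiffAt (isOpen_interior.mem_nhds hx)

theorem hasDerivAt_line (hb : IsSelfConcordantBarrier X ν R) {x h : E n} {s : ℝ}
    (hx : x + s • h ∈ interior X) :
    HasDerivAt (fun s : ℝ => R (x + s • h)) (inner ℝ (gradient R (x + s • h)) h) s := by
  have := hasDerivAt_iteratedFDeriv_line (k := 0) (by norm_num) (hb.contDiffAt hx)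
  simpa [inner_gradient_left, iteratedFDeriv_one_apply] using this

theorem hasDerivAt_gradient_line (hb : IsSelfConcordantBarrier X ν R) {x h : E n} {s : ℝ}
    (hx : x + s • h ∈ interior X) :
    HasDerivAt (fun s : ℝ => inner ℝ (gradient R (x + s • h)) h) (hessForm R (x + s • h) h) s := by
  have := hasDerivAt_iteratedFDeriv_line (k := 1) (by norm_num) (hb.contDiffAt hx)
  simpa [inner_gradient_left, iteratedFDeriv_one_apply, hessForm_eq] using this

theorem hasDerivAt_hessForm_line (hb : IsSelfConcordantBarrier X ν R) {x h : E n} {s : ℝ}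
    (hx : x + s • h ∈ interior X) :
    HasDerivAt (fun s : ℝ => hessForm R (x + s • h) h)
      (iteratedFDeriv ℝ 3 R (x + s • h) ![h, h, h]) s := by
  have := hasDerivAt_iteratedFDeriv_line (k := 2) (by norm_num) (hb.contDiffAt hx)
  have e : (![h, h, h] : Fin 3 → E n) = fun _ => h := by ext i; fin_cases i <;> rfl
  simpa only [hessForm_eq, e] using this

/-- Convexity makes the slope of `R` along a line monotone; the form is the derivative of this
slope. -/
theorem hessForm_nonneg (hb : IsSelfConcordantBarrier X ν R) {x : E n} (hx : x ∈ interior X)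
    (h : E n) : 0 ≤ hessForm R x h := by
  let S : Set ℝ := (fun s : ℝ => x + s • h) ⁻¹' interior X
  have hSo : IsOpen S := isOpen_interior.preimage (by fun_prop)
  have h0 : (0 : ℝ) ∈ S := by simpa [S] using hx
  have hconv : ConvexOn ℝ S (fun s : ℝ => R (x + s • h)) := by
    have := hb.convexOn.comp_affineMap (AffineMap.lineMap x (x + h) : ℝ →ᵃ[ℝ] E n)
    have e : ⇑(AffineMap.lineMap x (x + h) : ℝ →ᵃ[ℝ] E n) = fun s : ℝ => x + s • h := by
      funext s; simp [AffineMap.lineMap_apply, add_comm]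
    rw [e] at this
    exact this
  have hm : MonotoneOn (fun s : ℝ => inner ℝ (gradient R (x + s • h)) h) S := by
    have := hconv.monotoneOn_deriv (fun s hs => (hb.hasDerivAt_line hs).differentiableAt)
    intro a ha b hb' hab
    have := this ha hb' hab
    rwa [(hb.hasDerivAt_line ha).deriv, (hb.hasDerivAt_line hb').deriv] at this
  have := hm.derivWithin_nonneg (x := 0)
  rw [derivWithin_of_isOpen hSo h0, (hb.hasDerivAt_gradient_line h0).deriv] at this
  simpa using this

/-- Along a segment in the interior, the local norm of the direction (regularized by `ε`) varies
in a controlled way. -/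
theorem abs_inv_sqrt_hessForm_sub_le (hb : IsSelfConcordantBarrier X ν R) {x h : E n} {ε b : ℝ}
    (hε : 0 < ε) (hseg : ∀ s ∈ Set.Icc 0 b, x + s • h ∈ interior X) {s : ℝ}
    (hs : s ∈ Set.Icc 0 b) :
    |(√(hessForm R (x + s • h) h + ε))⁻¹ - (√(hessForm R x h + ε))⁻¹| ≤ s := by
  have := abs_inv_sqrt_sub_le (ψ := fun s => hessForm R (x + s • h) h + ε)
    (ψ' := fun s => iteratedFDeriv ℝ 3 R (x + s • h) ![h, h, h]) (b := b)
    (fun s hs => (hb.hasDerivAt_hessForm_line (hseg s hs)).add_const ε)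
    (fun s hs => by have := hb.hessForm_nonneg (hseg s hs) h; positivity)
    (fun s hs => (hb.third_le _ (hseg s hs) h).trans (by
      have := hb.hessForm_nonneg (hseg s hs) h
      have := Real.rpow_le_rpow this (le_add_of_nonneg_right hε.le) (by norm_num : (0 : ℝ) ≤ 3 / 2)
      unfold hessForm at *
      linarith)) s hs
  simpa using this

theorem add_smul_mem_interior (hX : Convex ℝ X) {x h : E n}
    (hx : x ∈ interior X) (hxh : x + h ∈ interior X) {s : ℝ} (hs : s ∈ Set.Icc (0 : ℝ) 1) :
    x + s • h ∈ interior X := by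
  have := hX.interior hx hxh (sub_nonneg.2 hs.2) hs.1 (by ring)
  convert this using 1
  module

/-- Along the segment the second derivative `ψ` of `R` plus the quadratic satisfies `1/√ψ(s) ≤ 1/r +
s`; integrate `ψ ≥ (r/(1 + rs))²` twice. The quadratic term itself serves as the regularization `ε`,
so the Hessian may be degenerate. -/
theorem sub_log_le_bregman (hb : IsSelfConcordantBarrier X ν R) (hX : Convex ℝ X) {x h : E n}
    (hx : x ∈ interior X) (hxh : x + h ∈ interior X) {c : ℝ} (hc : 0 < c) :
    √(hessForm R x h + c * ‖h‖ ^ 2) - Real.log (1 + √(hessForm R x h + c * ‖h‖ ^ 2)) ≤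
      bregman R (x + h) x + c / 2 * ‖h‖ ^ 2 := by
  rcases eq_or_ne h 0 with rfl | h0
  · have : hessForm R x 0 = 0 := by
      rw [hessForm_eq]; exact ContinuousMultilinearMap.map_zero _
    simp [this, bregman]
  have hseg : ∀ s ∈ Set.Icc (0 : ℝ) 1, x + s • h ∈ interior X :=
    fun s hs => add_smul_mem_interior hX hx hxh hs
  have hε : 0 < c * ‖h‖ ^ 2 := by have := norm_pos_iff.2 h0; positivity
  set r := √(hessForm R x h + c * ‖h‖ ^ 2) with hr
  have hrpos : 0 < r := Real.sqrt_pos.2 (by have := hb.hessForm_nonneg hx h; positivity)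
  have key := sub_log_le_of_second_deriv (r := r)
    (φ := fun s => R (x + s • h) + c / 2 * ‖h‖ ^ 2 * s ^ 2)
    (φ' := fun s => inner ℝ (gradient R (x + s • h)) h + c * ‖h‖ ^ 2 * s)
    (ψ := fun s => hessForm R (x + s • h) h + c * ‖h‖ ^ 2) hrpos.le
    (fun s hs => by
      convert! (hb.hasDerivAt_line (hseg s hs)).add
        ((hasDerivAt_pow 2 s).const_mul (c / 2 * ‖h‖ ^ 2)) using 1
      norm_num; ring)
    (fun s hs => by
      convert! (hb.hasDerivAt_gradient_line (hseg s hs)).add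
        ((hasDerivAt_id s).const_mul (c * ‖h‖ ^ 2)) using 1
      simp)
    (fun s hs => by
      have h1 := (abs_le.1 (hb.abs_inv_sqrt_hessForm_sub_le hε hseg hs)).2
      rw [← hr] at h1
      have hψ : 0 < hessForm R (x + s • h) h + c * ‖h‖ ^ 2 := by
        have := hb.hessForm_nonneg (hseg s hs) h; positivity
      have hq := Real.sqrt_pos.2 hψ
      rw [← Real.sq_sqrt hψ.le]
      have hs0 := hs.1
      have h2 : r / (1 + r * s) = (r⁻¹ + s)⁻¹ := by field_simp
      rw [h2]
      have : (r⁻¹ + s)⁻¹ ≤ √(hessForm R (x + s • h) h + c * ‖h‖ ^ 2) := by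
        rw [inv_le_comm₀ (by positivity) hq]; linarith
      gcongr)
  simp only [one_smul, zero_smul, add_zero] at key
  unfold bregman
  simp only [add_sub_cancel_left]
  linarith

theorem bregman_nonneg (hb : IsSelfConcordantBarrier X ν R) (hX : Convex ℝ X) {x y : E n}
    (hx : x ∈ interior X) (hy : y ∈ interior X) : 0 ≤ bregman R y x := by
  refine le_of_forall_pos_le_add fun ε hε => ?_
  -- This coefficient makes the added quadratic term at most `ε`, whatever the distance of the two
  -- points.
  have hc : 0 < ε / (‖y - x‖ ^ 2 + 1) := by positivity
  have h := hb.sub_log_le_bregman hX (h := y - x) hx (by simpa using hy) hc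
  set q := √(hessForm R x (y - x) + ε / (‖y - x‖ ^ 2 + 1) * ‖y - x‖ ^ 2)
  have h1 : Real.log (1 + q) ≤ 1 + q - 1 := Real.log_le_sub_one_of_pos (by positivity)
  have h2 : ε / (‖y - x‖ ^ 2 + 1) / 2 * ‖y - x‖ ^ 2 ≤ ε := by
    rw [div_div, div_mul_eq_mul_div, div_le_iff₀ (by positivity)]
    nlinarith [mul_nonneg hε.le (sq_nonneg ‖y - x‖)]
  rw [add_sub_cancel] at h
  linarith

theorem gradient_monotone (hb : IsSelfConcordantBarrier X ν R) (hX : Convex ℝ X) {x y : E n}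
    (hx : x ∈ interior X) (hy : y ∈ interior X) :
    0 ≤ inner ℝ (gradient R x - gradient R y) (x - y) := by
  have h1 := hb.bregman_nonneg hX hx hy
  have h2 := hb.bregman_nonneg hX hy hx
  unfold bregman at h1 h2
  have h3 : inner ℝ (gradient R x) (y - x) = - inner ℝ (gradient R x) (x - y) := by
    rw [← inner_neg_right, neg_sub]
  rw [inner_sub_left]
  linarith

/-- The open Dikin ellipsoid is contained in the interior. -/
theorem add_mem_interior (hb : IsSelfConcordantBarrier X ν R) {x h : E n}
    (hx : x ∈ interior X) (hh : hessForm R x h < 1) : x + h ∈ interior X := by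
  by_contra hne
  have hcomp : IsCompact (Set.Icc (0 : ℝ) 1 ∩ (fun s : ℝ => x + s • h) ⁻¹' (interior X)ᶜ) :=
    isCompact_Icc.inter_right (isOpen_interior.isClosed_compl.preimage (by fun_prop))
  -- The first exit time `b` of the segment. The exit point lies on the frontier, so `R` must blow
  -- up there; the bounds below show that it stays bounded on `[0, b)`.
  obtain ⟨b, ⟨hb01, hbU⟩, hbmin⟩ := hcomp.exists_isLeast ⟨1, by simp, by simpa using hne⟩
  have hlt : ∀ s ∈ Set.Ico 0 b, x + s • h ∈ interior X := fun s hs => by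
    by_contra hc
    exact absurd (hbmin ⟨⟨hs.1, hs.2.le.trans hb01.2⟩, hc⟩) (not_le.2 hs.2)
  have hb0 : 0 < b := by
    rcases hb01.1.eq_or_lt with h0 | h0
    · rw [← h0] at hbU; simp [hx] at hbU
    · exact h0
  have htend : Filter.Tendsto (fun s : ℝ => x + s • h) (nhdsWithin b (Set.Ico 0 b))
      (nhdsWithin (x + b • h) (interior X)) := by
    refine tendsto_nhdsWithin_iff.2 ⟨?_, ?_⟩
    · exact (Continuous.tendsto (by fun_prop) b).mono_left nhdsWithin_le_nhds
    · filter_upwards [self_mem_nhdsWithin] with s hs using hlt s hs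
  have : (nhdsWithin b (Set.Ico 0 b)).NeBot := by
    rw [← mem_closure_iff_nhdsWithin_neBot, closure_Ico hb0.ne]; exact ⟨hb0.le, le_rfl⟩
  have hfr : x + b • h ∈ frontier X := by
    refine ⟨?_, hbU⟩
    have : x + b • h ∈ closure (interior X) := by
      rw [mem_closure_iff_nhdsWithin_neBot]; exact htend.neBot
    exact closure_mono interior_subset this
  have hat := (hb.tendsto_atTop _ hfr).comp htend
  obtain ⟨ε, hε, hε1⟩ : ∃ ε > 0, hessForm R x h + ε < 1 :=
    ⟨(1 - hessForm R x h) / 2, by linarith, by linarith⟩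
  set r := √(hessForm R x h + ε) with hr
  have hform := hb.hessForm_nonneg hx h
  have hr0 : 0 < r := Real.sqrt_pos.2 (by positivity)
  have hr1 : 0 < r⁻¹ - 1 := by
    have : r < 1 := (Real.sqrt_lt' one_pos).2 (by simpa using hε1)
    have := one_lt_inv₀ hr0 |>.2 this
    linarith
  -- From `1/√ψ(s) ≥ 1/r - s ≥ 1/r - 1 > 0`, the second derivative is at most `K` before the exit.
  -- Two mean value estimates then bound the slope and `R`.
  set K := ((r⁻¹ - 1)⁻¹) ^ 2
  have hψ : ∀ s ∈ Set.Ico 0 b, ‖hessForm R (x + s • h) h‖ ≤ K := fun s hs => by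
    have hsub : Set.Icc 0 s ⊆ Set.Ico 0 b := fun t ht => ⟨ht.1, ht.2.trans_lt hs.2⟩
    have h1 := (abs_le.1 (hb.abs_inv_sqrt_hessForm_sub_le hε (fun t ht => hlt t (hsub ht))
      ⟨hs.1, le_rfl⟩)).1
    rw [← hr] at h1
    have hnn := hb.hessForm_nonneg (hlt s hs) h
    have hp : 0 < hessForm R (x + s • h) h + ε := by positivity
    have hq := Real.sqrt_pos.2 hp
    have h2 : √(hessForm R (x + s • h) h + ε) ≤ (r⁻¹ - 1)⁻¹ := by
      rw [le_inv_comm₀ hq hr1]; linarith [hs.2, hb01.2]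
    have h3 : √(hessForm R (x + s • h) h + ε) ^ 2 ≤ K := by unfold K; gcongr
    rw [Real.sq_sqrt hp.le] at h3
    rw [Real.norm_of_nonneg hnn]; linarith
  have h0 : (0 : ℝ) ∈ Set.Ico 0 b := ⟨le_rfl, hb0⟩
  have hg : ∀ s ∈ Set.Ico 0 b, ‖inner ℝ (gradient R (x + s • h)) h‖ ≤
      ‖inner ℝ (gradient R x) h‖ + K := fun s hs => by
    have := (convex_Ico 0 b).norm_image_sub_le_of_norm_hasDerivWithin_le
      (fun s hs => (hb.hasDerivAt_gradient_line (hlt s hs)).hasDerivWithinAt) hψ h0 hs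
    have hK : 0 ≤ K := by positivity
    have h2 : K * ‖s - 0‖ ≤ K := by
      rw [sub_zero, Real.norm_of_nonneg hs.1]
      nlinarith [hs.2, hb01.2]
    simp only [zero_smul, add_zero] at this
    have h4 := norm_sub_norm_le (inner ℝ (gradient R (x + s • h)) h) (inner ℝ (gradient R x) h)
    linarith
  have hR : ∀ s ∈ Set.Ico 0 b, R (x + s • h) ≤ R x + (‖inner ℝ (gradient R x) h‖ + K) :=
      fun s hs => by
    have := (convex_Ico 0 b).norm_image_sub_le_of_norm_hasDerivWithin_le
      (fun s hs => (hb.hasDerivAt_line (hlt s hs)).hasDerivWithinAt) hg h0 hs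
    have hK : 0 ≤ ‖inner ℝ (gradient R x) h‖ + K := by positivity
    have h2 : (‖inner ℝ (gradient R x) h‖ + K) * ‖s - 0‖ ≤ ‖inner ℝ (gradient R x) h‖ + K := by
      rw [sub_zero, Real.norm_of_nonneg hs.1]
      nlinarith [hs.2, hb01.2]
    simp only [zero_smul, add_zero] at this
    have h4 := le_abs_self (R (x + s • h) - R x)
    rw [← Real.norm_eq_abs] at h4
    linarith
  obtain ⟨s, hs1, hs2⟩ := ((hat.eventually_gt_atTop _).and self_mem_nhdsWithin).exists
  exact absurd (hR s hs2) (not_le.2 hs1)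

/-- Logarithmic growth of a barrier along a segment to a point of the set. -/
theorem sub_le_log (hb : IsSelfConcordantBarrier X ν R) (hX : Convex ℝ X) {x y : E n}
    (hx : x ∈ interior X) (hy : y ∈ X) {s : ℝ} (hs : s ∈ Set.Ico (0 : ℝ) 1) :
    R (x + s • (y - x)) - R x ≤ -(max ν 0 + 1) * Real.log (1 - s) := by
  have hseg : ∀ s ∈ Set.Ico (0 : ℝ) 1, x + s • (y - x) ∈ interior X := fun s hs => by
    have := hX.add_smul_sub_mem_interior hy hx (t := 1 - s) ⟨by linarith [hs.2], by linarith [hs.1]⟩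
    convert this using 1
    module
  -- No sign of `ν` is assumed; `max ν 0 + 1` is positive and dominates `√ν ^ 2` in both cases.
  have := sub_le_log_of_sq_deriv_le (ν := max ν 0 + 1) (by positivity)
    (fun s hs => hb.hasDerivAt_line (hseg s hs))
    (fun s hs => hb.hasDerivAt_gradient_line (hseg s hs))
    (fun s hs => by
      have h1 := hb.first_le _ (hseg s hs) (y - x)
      have hnn := hb.hessForm_nonneg (hseg s hs) (y - x)
      change _ ≤ √ν * √(hessForm R (x + s • (y - x)) (y - x)) at h1
      rw [← sq_abs]
      calc _ ≤ (√ν * √(hessForm R (x + s • (y - x)) (y - x))) ^ 2 := by gcongr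
        _ = √ν ^ 2 * hessForm R (x + s • (y - x)) (y - x) := by rw [mul_pow, Real.sq_sqrt hnn]
        _ ≤ _ := by
          gcongr
          rcases le_total ν 0 with h | h
          · rw [Real.sqrt_eq_zero_of_nonpos h]; linarith [le_max_right ν 0]
          · rw [Real.sq_sqrt h]; linarith [le_max_left ν 0]) hs
  simpa using this

/-- A barrier plus a continuous function attains its minimum over the interior. -/
theorem exists_isMinOn (hb : IsSelfConcordantBarrier X ν R) (hX : IsCompact X)
    (hne : (interior X).Nonempty) {g : E n → ℝ} (hg : Continuous g) :
    ∃ x ∈ interior X, ∀ y ∈ interior X, R x + g x ≤ R y + g y := by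
  obtain ⟨x₀, hx₀⟩ := hne
  have hRc : ContinuousOn (fun x => R x + g x) (interior X) :=
    hb.contDiffOn.continuousOn.add hg.continuousOn
  -- A sublevel set is closed in the whole space, since `R + g` tends to infinity at the frontier;
  -- it is therefore compact.
  set K := interior X ∩ {x | R x + g x ≤ R x₀ + g x₀} with hK
  have hKc : IsCompact K := by
    refine hX.of_isClosed_subset ?_ fun x hx => interior_subset hx.1
    refine isClosed_of_closure_subset fun b hbK => ?_
    have : (nhdsWithin b K).NeBot := mem_closure_iff_nhdsWithin_neBot.1 hbK
    have hev : ∀ᶠ x in nhdsWithin b K, R x + g x ≤ R x₀ + g x₀ := by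
      filter_upwards [self_mem_nhdsWithin] with x hx using hx.2
    have hmono : nhdsWithin b K ≤ nhdsWithin b (interior X) :=
      nhdsWithin_mono _ Set.inter_subset_left
    by_cases hbi : b ∈ interior X
    · exact ⟨hbi, le_of_tendsto ((hRc b hbi).mono_left hmono) hev⟩
    · exfalso
      have hfr : b ∈ frontier X :=
        ⟨closure_mono (fun x hx => interior_subset hx.1) hbK, hbi⟩
      have h1 := ((hb.tendsto_atTop b hfr).mono_left hmono).atTop_add
        (hg.tendsto b |>.mono_left (nhdsWithin_le_nhds (s := K)))
      obtain ⟨x, hx1, hx2⟩ := ((h1.eventually_gt_atTop (R x₀ + g x₀)).and hev).exists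
      exact absurd hx2 (not_le.2 hx1)
  obtain ⟨x, hxK, hmin⟩ := hKc.exists_isMinOn ⟨x₀, hx₀, le_refl (R x₀ + g x₀)⟩
    (hRc.mono Set.inter_subset_left)
  refine ⟨x, hxK.1, fun y hy => ?_⟩
  by_cases hyK : y ∈ K
  · exact hmin hyK
  · have : R x₀ + g x₀ < R y + g y := by
      by_contra! hc; exact hyK ⟨hy, hc⟩
    exact hxK.2.trans this.le

theorem differentiableAt (hb : IsSelfConcordantBarrier X ν R) {x : E n} (hx : x ∈ interior X) :
    DifferentiableAt ℝ R x :=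
  (hb.contDiffAt hx).differentiableAt (by norm_num)

theorem continuousOn_gradient (hb : IsSelfConcordantBarrier X ν R) :
    ContinuousOn (gradient R) (interior X) := by
  have := hb.contDiffOn.continuousOn_fderiv_of_isOpen isOpen_interior (by norm_num)
  exact (InnerProductSpace.toDual ℝ (E n)).symm.continuous.comp_continuousOn this

theorem argminOn_spec (hb : IsSelfConcordantBarrier X ν R) (hX : IsCompact X)
    (hne : (interior X).Nonempty) :
    argminOn (interior X) R ∈ interior X ∧
      ∀ y ∈ interior X, R (argminOn (interior X) R) ≤ R y := by
  obtain ⟨x, hx, hx'⟩ := hb.exists_isMinOn hX hne (g := fun _ => 0) continuous_const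
  exact Classical.epsilon_spec (p := fun x => x ∈ interior X ∧ ∀ y ∈ interior X, R x ≤ R y)
    ⟨x, hx, by simpa using hx'⟩

theorem gradient_argminOn (hb : IsSelfConcordantBarrier X ν R) (hX : IsCompact X)
    (hne : (interior X).Nonempty) : gradient R (argminOn (interior X) R) = 0 := by
  obtain ⟨h1, h2⟩ := hb.argminOn_spec hX hne
  have : IsLocalMin R (argminOn (interior X) R) := by
    filter_upwards [isOpen_interior.mem_nhds h1] with y hy using h2 y hy
  simp [gradient, this.fderiv_eq_zero]

/-- The prox-mapping stays in the interior and satisfies the first-order condition. -/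
theorem prox_spec (hb : IsSelfConcordantBarrier X ν R) (hX : IsCompact X)
    (η c : ℝ) {x : E n} (hx : x ∈ interior X) (w : E n) :
    prox X R η c x w ∈ interior X ∧
      gradient R (prox X R η c x w) + c • prox X R η c x w = gradient R x + c • x + η • w := by
  obtain ⟨y, hy, hy'⟩ := hb.exists_isMinOn hX ⟨x, hx⟩ (g := fun x' =>
    η * inner ℝ w (x - x') + c / 2 * ‖x - x'‖ ^ 2 - R x - inner ℝ (gradient R x) (x' - x))
    (by fun_prop)
  have hspec := Classical.epsilon_spec (p := fun x' => x' ∈ interior X ∧ ∀ y ∈ interior X,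
    η * inner ℝ w (x - x') + c / 2 * ‖x - x'‖ ^ 2 + bregman R x' x ≤
    η * inner ℝ w (x - y) + c / 2 * ‖x - y‖ ^ 2 + bregman R y x)
    ⟨y, hy, fun z hz => by have := hy' z hz; unfold bregman; linarith⟩
  change prox X R η c x w ∈ interior X ∧ _ at hspec
  refine ⟨hspec.1, ?_⟩
  obtain ⟨h1, h2⟩ := hspec
  set p := prox X R η c x w with hp
  have hloc : IsLocalMin (fun y => η * inner ℝ w (x - y) + c / 2 * ‖x - y‖ ^ 2 + bregman R y x)
      p := by
    filter_upwards [isOpen_interior.mem_nhds h1] with y hy using h2 y hy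
  have hsub : HasFDerivAt (fun y : E n => x - y) (-ContinuousLinearMap.id ℝ (E n)) p := by
    simpa using (hasFDerivAt_id p).const_sub x
  have hsub' : HasFDerivAt (fun y : E n => y - x) (ContinuousLinearMap.id ℝ (E n)) p :=
    (hasFDerivAt_id p).sub_const x
  have hd1 := (((innerSL ℝ w).hasFDerivAt.comp p hsub).const_mul η).add
    ((hsub.norm_sq).const_mul (c / 2))
  have hd2 := (((hb.differentiableAt h1).hasFDerivAt.sub_const (R x)).sub
    ((innerSL ℝ (gradient R x)).hasFDerivAt.comp p hsub'))
  have hz := hloc.hasFDerivAt_eq_zero (hd1.add hd2)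
  refine ext_inner_right ℝ fun k => ?_
  have hk := congrArg (fun f => f k) hz
  simp [← inner_gradient_left] at hk
  simp only [inner_add_left, inner_smul_left, RCLike.conj_to_real]
  linarith

/-- The map `∇R + c·id` is inverted by the prox-mapping, so this estimate is what makes the
prox-mapping Lipschitz in its data. -/
theorem gradient_strongly_monotone (hb : IsSelfConcordantBarrier X ν R) (hX : Convex ℝ X) {c : ℝ}
    {x y : E n} (hx : x ∈ interior X) (hy : y ∈ interior X) :
    c * ‖x - y‖ ^ 2 ≤
      inner ℝ ((gradient R x + c • x) - (gradient R y + c • y)) (x - y) := by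
  have := hb.gradient_monotone hX hx hy
  have e : (gradient R x + c • x) - (gradient R y + c • y) =
    (gradient R x - gradient R y) + c • (x - y) := by module
  rw [e, inner_add_left, inner_smul_left, real_inner_self_eq_norm_sq]
  simpa using this

/-- The mirror step inequality. -/
theorem prox_descent (hb : IsSelfConcordantBarrier X ν R) (hXc : IsCompact X) (hX : Convex ℝ X)
    {η c l : ℝ} (hc : 0 < c) (hl : l ≤ 1 / 2) {x p w : E n} (hx : x ∈ interior X)
    (hw : ∀ h : E n, η * inner ℝ w h ≤ l * √(hessForm R x h + c * ‖h‖ ^ 2)) :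
    bregman R p (prox X R η c x w) + c / 2 * ‖p - prox X R η c x w‖ ^ 2 ≤
      bregman R p x + c / 2 * ‖p - x‖ ^ 2 + η * inner ℝ w (x - p) + 2 * l ^ 2 := by
  obtain ⟨hy, hfo⟩ := hb.prox_spec hXc η c hx w
  set y := prox X R η c x w
  have h1 := hb.sub_log_le_bregman hX (h := y - x) hx (by simpa using hy) hc
  have h2 := hw (y - x)
  have h3 := mul_sub_add_log_le hl (Real.sqrt_nonneg (hessForm R x (y - x) + c * ‖y - x‖ ^ 2))
  rw [add_sub_cancel] at h1
  have hg : gradient R y = gradient R x + c • x + η • w - c • y := by rw [← hfo]; module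
  -- The three-point identity, exact once the first-order condition is substituted for `∇R(y)`. Its
  -- last bracket is at most `l r - (r - log (1 + r)) ≤ 2 l²`.
  have e : bregman R p y + c / 2 * ‖p - y‖ ^ 2 = bregman R p x + c / 2 * ‖p - x‖ ^ 2 +
      η * inner ℝ w (x - p) + (η * inner ℝ w (y - x) - (bregman R y x + c / 2 * ‖y - x‖ ^ 2)) := by
    unfold bregman
    rw [hg]
    simp only [norm_sub_sq_real, inner_add_left, inner_sub_left, inner_sub_right, inner_smul_left,
      RCLike.conj_to_real, real_inner_self_eq_norm_sq, real_inner_comm x p, real_inner_comm y p,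
      real_inner_comm x y]
    ring
  linarith

end IsSelfConcordantBarrier

end Barrier

section Scaling

/-! ### The scaling matrices -/

theorem toEuclideanLin_mul_apply {n : ℕ} (A B : Matrix (Fin n) (Fin n) ℝ) (z : E n) :
    Matrix.toEuclideanLin (A * B) z = Matrix.toEuclideanLin A (Matrix.toEuclideanLin B z) := by
  simp

theorem inner_toEuclideanLin_comm {n : ℕ} {A : Matrix (Fin n) (Fin n) ℝ} (hA : A.IsHermitian)
    (y z : E n) :
    inner ℝ (Matrix.toEuclideanLin A y) z = inner ℝ y (Matrix.toEuclideanLin A z) :=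
  Matrix.isSymmetric_toEuclideanLin_iff.2 hA y z

theorem le_of_mem_spectrum {n : ℕ} {M : Matrix (Fin n) (Fin n) ℝ} (hM : M.IsHermitian) {c : ℝ}
    (hc : ∀ h : E n, c * ‖h‖ ^ 2 ≤ inner ℝ h (Matrix.toEuclideanLin M h)) {s : ℝ}
    (hs : s ∈ spectrum ℝ M) : c ≤ s := by
  rw [hM.spectrum_real_eq_range_eigenvalues] at hs
  obtain ⟨i, rfl⟩ := hs
  have h1 := hc (hM.eigenvectorBasis i)
  have h2 : Matrix.toEuclideanLin M (hM.eigenvectorBasis i) =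
      hM.eigenvalues i • hM.eigenvectorBasis i := by
    ext j
    have := congrFun (hM.mulVec_eigenvectorBasis i) j
    simpa using this
  rw [h2, inner_smul_right, real_inner_self_eq_norm_sq] at h1
  simpa using h1

theorem continuousOn_rpow_neg_half {s : Set ℝ} (hs : ∀ t ∈ s, 0 < t) :
    ContinuousOn (fun t : ℝ => t ^ (-(1 / 2) : ℝ)) s :=
  fun t ht => (Real.continuousAt_rpow_const t _ (Or.inl (hs t ht).ne')).continuousWithinAt

/-- On the positive spectrum, `s^{-1/2} · s · s^{-1/2} = 1`; the functional calculus carries this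
over to matrices. -/
theorem cfc_rpow_neg_half_mul_mul {n : ℕ} {M : Matrix (Fin n) (Fin n) ℝ} (hM : M.IsHermitian)
    (hpos : ∀ t ∈ spectrum ℝ M, 0 < t) :
    cfc (fun s : ℝ => s ^ (-(1 / 2) : ℝ)) M * (M * cfc (fun s : ℝ => s ^ (-(1 / 2) : ℝ)) M) = 1 := by
  have hsa : IsSelfAdjoint M := hM
  have hf := continuousOn_rpow_neg_half hpos
  have h1 : M * cfc (fun s : ℝ => s ^ (-(1 / 2) : ℝ)) M =
      cfc (fun s : ℝ => s * s ^ (-(1 / 2) : ℝ)) M := by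
    conv_lhs => rw [show M * cfc (fun s : ℝ => s ^ (-(1 / 2) : ℝ)) M =
      cfc (fun s : ℝ => s) M * cfc (fun s : ℝ => s ^ (-(1 / 2) : ℝ)) M by rw [cfc_id' ℝ M]]
    rw [← cfc_mul (fun s : ℝ => s) (fun s : ℝ => s ^ (-(1 / 2) : ℝ)) M continuousOn_id hf]
  rw [h1, ← cfc_mul (fun s : ℝ => s ^ (-(1 / 2) : ℝ)) (fun s : ℝ => s * s ^ (-(1 / 2) : ℝ)) M hf
    (continuousOn_id.mul hf), ← cfc_one (R := ℝ) (a := M)]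
  refine cfc_congr fun s hs => ?_
  have hs0 := hpos s hs
  have : s ^ (-(1 / 2) : ℝ) * (s * s ^ (-(1 / 2) : ℝ)) =
      s ^ (-(1 / 2) : ℝ) * s ^ (-(1 / 2) : ℝ) * s := by ring
  simp only [this, Pi.one_apply]
  rw [← Real.rpow_add hs0]
  norm_num
  rw [Real.rpow_neg_one, inv_mul_cancel₀ hs0.ne']

-- The functional calculus is continuous as long as the spectra stay locally in one compact interval
-- where the function is continuous. The lower bound `c` avoids the singularity at zero, and the
-- norm gives a local upper bound.
open scoped Matrix.Norms.L2Operator in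
theorem continuousOn_cfc_rpow_neg_half {α : Type*} [TopologicalSpace α] {n : ℕ}
    {M : α → Matrix (Fin n) (Fin n) ℝ} {S : Set α} (hM : ContinuousOn M S)
    (hH : ∀ x ∈ S, (M x).IsHermitian) {c : ℝ} (hc0 : 0 < c)
    (hc : ∀ x ∈ S, ∀ t ∈ spectrum ℝ (M x), c ≤ t) :
    ContinuousOn (fun x => cfc (fun s : ℝ => s ^ (-(1 / 2) : ℝ)) (M x)) S := by
  have hnorm : ContinuousOn (fun x => ‖M x‖ * ‖(1 : Matrix (Fin n) (Fin n) ℝ)‖) S :=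
    hM.norm.mul continuousOn_const
  refine ContinuousOn.cfc (s := fun x =>
      Set.Icc c (‖M x‖ * ‖(1 : Matrix (Fin n) (Fin n) ℝ)‖ + 1)) _
    (fun x _ => isCompact_Icc) hM ?_ (fun x hx => hH x hx)
    (fun x hx => continuousOn_rpow_neg_half fun t ht => hc0.trans_le ht.1)
  intro x hx
  filter_upwards [(hnorm x hx).eventually_lt continuousWithinAt_const (lt_add_one _),
    self_mem_nhdsWithin] with y hy hyS t ht
  refine ⟨hc y hyS t ht, ?_⟩
  have := spectrum.norm_le_norm_mul_of_mem ht
  exact (le_abs_self t).trans (this.trans hy.le)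

variable {n : ℕ} {X : Set (E n)} {ν : ℝ} {R : E n → ℝ}

namespace IsSelfConcordantBarrier

theorem hessian_apply (x : E n) (j k : Fin n) :
    hessian R x j k = fderiv ℝ (fderiv ℝ R) x (EuclideanSpace.single j 1)
      (EuclideanSpace.single k 1) := by
  simp [hessian, iteratedFDeriv_two_apply]

theorem isHermitian_hessian (hb : IsSelfConcordantBarrier X ν R) {x : E n}
    (hx : x ∈ interior X) : (hessian R x).IsHermitian := by
  ext j k
  simp only [Matrix.conjTranspose_apply, hessian_apply, star_trivial]
  exact (hb.contDiffAt hx).isSymmSndFDerivAt (by simp; norm_num) _ _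

theorem inner_hessian (x h : E n) :
    inner ℝ h (Matrix.toEuclideanLin (hessian R x) h) = hessForm R x h := by
  have hh : h = ∑ j, h j • EuclideanSpace.single j (1 : ℝ) := by
    ext k; simp [Finset.sum_apply, Pi.single_apply]
  have e : hessForm R x h = ∑ j, ∑ k, h j * h k * hessian R x j k := by
    unfold hessForm
    rw [iteratedFDeriv_two_apply]
    simp only [Matrix.cons_val_zero, Matrix.cons_val_one, hessian_apply]
    conv_lhs => rw [hh]
    simp only [map_sum, sum_apply, map_smul, smul_apply,
      smul_eq_mul, Finset.mul_sum]
    rw [Finset.sum_comm]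
    refine Finset.sum_congr rfl fun j _ => Finset.sum_congr rfl fun k _ => by ring
  rw [e, PiLp.inner_apply]
  refine Finset.sum_congr rfl fun j _ => ?_
  simp only [Matrix.ofLp_toLpLin, Matrix.toLin'_apply, Matrix.mulVec, dotProduct,
    RCLike.inner_apply, conj_trivial, Finset.sum_mul]
  refine Finset.sum_congr rfl fun k _ => by ring

theorem continuousOn_hessian (hb : IsSelfConcordantBarrier X ν R) :
    ContinuousOn (hessian R) (interior X) := by
  have h1 : ContinuousOn (iteratedFDeriv ℝ 2 R) (interior X) := by
    intro x hx
    exact ((hb.contDiffAt hx).differentiableAt_iteratedFDeriv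
      (by norm_num)).continuousAt.continuousWithinAt
  refine continuousOn_pi.2 fun j => continuousOn_pi.2 fun k => ?_
  exact (ContinuousMultilinearMap.apply ℝ (fun _ : Fin 2 => E n) ℝ _).continuous.comp_continuousOn h1

variable {c : ℝ}

theorem isHermitian_hessian_add (hb : IsSelfConcordantBarrier X ν R) {x : E n}
    (hx : x ∈ interior X) : (hessian R x + c • (1 : Matrix (Fin n) (Fin n) ℝ)).IsHermitian :=
  (hb.isHermitian_hessian hx).add (by simp [Matrix.IsHermitian])

theorem inner_hessian_add (x h : E n) :
    inner ℝ h (Matrix.toEuclideanLin (hessian R x + c • (1 : Matrix (Fin n) (Fin n) ℝ)) h) =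
      hessForm R x h + c * ‖h‖ ^ 2 := by
  rw [map_add, LinearMap.add_apply, inner_add_right, inner_hessian, map_smul,
    Matrix.toLpLin_one, LinearMap.smul_apply, LinearMap.id_apply, inner_smul_right,
    real_inner_self_eq_norm_sq]

theorem le_of_mem_spectrum_hessian_add (hb : IsSelfConcordantBarrier X ν R) {x : E n}
    (hx : x ∈ interior X) {s : ℝ}
    (hs : s ∈ spectrum ℝ (hessian R x + c • (1 : Matrix (Fin n) (Fin n) ℝ))) : c ≤ s :=
  le_of_mem_spectrum (hb.isHermitian_hessian_add hx) (fun h => by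
    rw [inner_hessian_add]; linarith [hb.hessForm_nonneg hx h]) hs

theorem isHermitian_scaling (R : E n → ℝ) (c : ℝ) (x : E n) :
    (scaling R c x).IsHermitian :=
  cfc_predicate _ _

theorem scaling_mul_mul (hb : IsSelfConcordantBarrier X ν R) (hc : 0 < c) {x : E n}
    (hx : x ∈ interior X) :
    scaling R c x * ((hessian R x + c • (1 : Matrix (Fin n) (Fin n) ℝ)) * scaling R c x) = 1 :=
  cfc_rpow_neg_half_mul_mul (hb.isHermitian_hessian_add hx)
    fun _ ht => hc.trans_le (hb.le_of_mem_spectrum_hessian_add hx ht)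

theorem isUnit_det_scaling (hb : IsSelfConcordantBarrier X ν R) (hc : 0 < c) {x : E n}
    (hx : x ∈ interior X) : IsUnit (scaling R c x).det :=
  Matrix.isUnit_det_of_right_inverse (hb.scaling_mul_mul hc hx)

/-- `A` maps the Euclidean norm isometrically to the regularized local norm, because `A (∇²R + cI) A
= 1`. -/
theorem hessForm_scaling (hb : IsSelfConcordantBarrier X ν R) (hc : 0 < c) {x : E n}
    (hx : x ∈ interior X) (z : E n) :
    hessForm R x (Matrix.toEuclideanLin (scaling R c x) z) +
      c * ‖Matrix.toEuclideanLin (scaling R c x) z‖ ^ 2 = ‖z‖ ^ 2 := by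
  rw [← inner_hessian_add, inner_toEuclideanLin_comm (isHermitian_scaling R c x),
    ← toEuclideanLin_mul_apply, ← toEuclideanLin_mul_apply, Matrix.mul_assoc,
    hb.scaling_mul_mul hc hx]
  simp

theorem norm_scaling_sq_le (hb : IsSelfConcordantBarrier X ν R) (hc : 0 < c) {x : E n}
    (hx : x ∈ interior X) (z : E n) :
    ‖Matrix.toEuclideanLin (scaling R c x) z‖ ^ 2 ≤ ‖z‖ ^ 2 / c := by
  rw [le_div_iff₀ hc]
  have h1 := hb.hessForm_scaling hc hx z
  have h2 := hb.hessForm_nonneg hx (Matrix.toEuclideanLin (scaling R c x) z)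
  linarith

/-- Feasibility of the play: the regularization takes a strictly positive share `c‖A z‖²` of `‖z‖² =
1`, so the point lies in the open Dikin ellipsoid. -/
theorem add_scaling_mem (hb : IsSelfConcordantBarrier X ν R) (hc : 0 < c) {x : E n}
    (hx : x ∈ interior X) {z : E n} (hz : ‖z‖ = 1) :
    x + Matrix.toEuclideanLin (scaling R c x) z ∈ interior X := by
  refine hb.add_mem_interior hx ?_
  have h1 := hb.hessForm_scaling hc hx z
  have h2 : Matrix.toEuclideanLin (scaling R c x) z ≠ 0 := by
    intro h0
    have e : hessForm R x 0 = 0 := by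
      rw [hessForm_eq]; exact ContinuousMultilinearMap.map_zero _
    rw [h0, e, hz] at h1
    simp at h1
  have h3 : 0 < c * ‖Matrix.toEuclideanLin (scaling R c x) z‖ ^ 2 := by
    have := norm_pos_iff.2 h2; positivity
  rw [hz] at h1
  linarith

theorem scaling_inv_scaling (hb : IsSelfConcordantBarrier X ν R) (hc : 0 < c) {x : E n}
    (hx : x ∈ interior X) (h : E n) :
    Matrix.toEuclideanLin (scaling R c x) (Matrix.toEuclideanLin (scaling R c x)⁻¹ h) = h := by
  rw [← toEuclideanLin_mul_apply, Matrix.mul_nonsing_inv _ (hb.isUnit_det_scaling hc hx)]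
  simp

/-- Identifies the norm in which the gradient estimate is controlled with the norm in which
`prox_descent` is stated. -/
theorem norm_inv_scaling_sq (hb : IsSelfConcordantBarrier X ν R) (hc : 0 < c) {x : E n}
    (hx : x ∈ interior X) (h : E n) :
    ‖Matrix.toEuclideanLin (scaling R c x)⁻¹ h‖ ^ 2 = hessForm R x h + c * ‖h‖ ^ 2 := by
  rw [← hb.hessForm_scaling hc hx, hb.scaling_inv_scaling hc hx]

theorem inner_inv_scaling (R : E n → ℝ) (c : ℝ) (x y z : E n) :
    inner ℝ (Matrix.toEuclideanLin (scaling R c x)⁻¹ y) z =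
      inner ℝ y (Matrix.toEuclideanLin (scaling R c x)⁻¹ z) :=
  inner_toEuclideanLin_comm (isHermitian_scaling R c x).inv y z

theorem continuousOn_scaling (hb : IsSelfConcordantBarrier X ν R) (hc : 0 < c) :
    ContinuousOn (scaling R c) (interior X) :=
  continuousOn_cfc_rpow_neg_half (hb.continuousOn_hessian.add continuousOn_const)
    (fun _ hx => hb.isHermitian_hessian_add hx) hc
    (fun _ hx _ ht => hb.le_of_mem_spectrum_hessian_add hx ht)

theorem continuousOn_inv_scaling (hb : IsSelfConcordantBarrier X ν R) (hc : 0 < c) :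
    ContinuousOn (fun x => (scaling R c x)⁻¹) (interior X) := by
  have : ContinuousOn (fun x => (scaling R c x).det⁻¹ • (scaling R c x).adjugate)
      (interior X) := by
    have h := hb.continuousOn_scaling hc
    refine ContinuousOn.smul (ContinuousOn.inv₀ ?_ fun x hx =>
      (hb.isUnit_det_scaling hc hx).ne_zero) ?_
    · exact (continuous_id.matrix_det).comp_continuousOn h
    · exact (continuous_id.matrix_adjugate).comp_continuousOn h
  refine this.congr fun x _ => ?_
  rw [Matrix.inv_def, Ring.inverse_eq_inv']

end IsSelfConcordantBarrier

theorem ContinuousOn.toEuclideanLin_apply {α : Type*} [TopologicalSpace α] {S : Set α}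
    {A : α → Matrix (Fin n) (Fin n) ℝ} {z : α → E n} (hA : ContinuousOn A S)
    (hz : ContinuousOn z S) : ContinuousOn (fun a => Matrix.toEuclideanLin (A a) (z a)) S := by
  have : Continuous fun p : Matrix (Fin n) (Fin n) ℝ × (Fin n → ℝ) =>
      WithLp.toLp 2 (p.1.mulVec p.2) :=
    (PiLp.continuous_toLp 2 _).comp (continuous_fst.matrix_mulVec continuous_snd)
  exact this.comp_continuousOn (hA.prodMk ((PiLp.continuous_ofLp 2 _).comp_continuousOn hz))

end Scaling

section Sphere

/-! ### The uniform distribution on the sphere -/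

variable {n : ℕ}

/-- The action of a linear isometry on the unit sphere. -/
def sphereMap (f : E n ≃ₗᵢ[ℝ] E n) (z : Metric.sphere (0 : E n) 1) : Metric.sphere (0 : E n) 1 :=
  ⟨f z, by simp⟩

theorem measurable_sphereMap (f : E n ≃ₗᵢ[ℝ] E n) : Measurable (sphereMap f) :=
  (f.continuous.measurable.comp measurable_subtype_coe).subtype_mk

-- The sphere measure is the volume of the cone over a set up to a constant factor; cones go to
-- cones under a linear isometry, and volume is preserved.
open scoped Pointwise in
theorem measurePreserving_sphereMap (f : E n ≃ₗᵢ[ℝ] E n) :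
    MeasurePreserving (sphereMap f) (sphereUniform n) (sphereUniform n) := by
  refine ⟨measurable_sphereMap f, ?_⟩
  unfold sphereUniform
  rw [Measure.map_smul]
  congr 1
  ext s hs
  rw [Measure.map_apply (measurable_sphereMap f) hs, Measure.toSphere_apply' _ hs,
    Measure.toSphere_apply' _ (measurable_sphereMap f hs)]
  congr 1
  have e : Set.Ioo (0 : ℝ) 1 • ((↑) '' (sphereMap f ⁻¹' s) : Set (E n)) =
      f ⁻¹' (Set.Ioo (0 : ℝ) 1 • ((↑) '' s)) := by
    ext x
    simp only [Set.mem_smul, Set.mem_image, Set.mem_preimage]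
    constructor
    · rintro ⟨r, hr, _, ⟨z, hz, rfl⟩, rfl⟩
      exact ⟨r, hr, _, ⟨sphereMap f z, hz, rfl⟩, by simp [sphereMap]⟩
    · rintro ⟨r, hr, _, ⟨z, hz, rfl⟩, hx⟩
      refine ⟨r, hr, _, ⟨sphereMap f.symm z, ?_, rfl⟩, ?_⟩
      · have : sphereMap f (sphereMap f.symm z) = z := by ext1; simp [sphereMap]
        rwa [this]
      · apply f.injective
        simp [sphereMap, hx]
  rw [e]
  exact f.measurePreserving.measure_preimage_equiv (f := f.toHomeomorph.toMeasurableEquiv) _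

theorem isProbabilityMeasure_sphereUniform (hn : 1 ≤ n) :
    IsProbabilityMeasure (sphereUniform n) := by
  have : NeZero n := ⟨by omega⟩
  have h0 : (volume : Measure (E n)).toSphere Set.univ ≠ 0 := by
    rw [Measure.measure_univ_ne_zero]
    exact Measure.toSphere_ne_zero _
  constructor
  rw [sphereUniform, Measure.smul_apply, smul_eq_mul]
  exact ENNReal.inv_mul_cancel h0 (measure_ne_top _ _)

theorem integral_inner_sq_eq (f : E n ≃ₗᵢ[ℝ] E n) (q : E n) :
    ∫ z, inner ℝ (z : E n) (f q) ^ 2 ∂sphereUniform n =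
      ∫ z, inner ℝ (z : E n) q ^ 2 ∂sphereUniform n := by
  rw [← (measurePreserving_sphereMap f).map_eq, integral_map (measurable_sphereMap f).aemeasurable
    (by rw [(measurePreserving_sphereMap f).map_eq]
        exact (Continuous.aestronglyMeasurable (by fun_prop)))]
  rw [(measurePreserving_sphereMap f).map_eq]
  simp [sphereMap]

/-- The second moment of a uniform direction is isotropic. -/
theorem integral_inner_sq (hn : 1 ≤ n) (q : E n) :
    ∫ z, inner ℝ (z : E n) q ^ 2 ∂sphereUniform n = ‖q‖ ^ 2 / n := by
  have := isProbabilityMeasure_sphereUniform hn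
  have key : ∀ j : Fin n, ∫ z, inner ℝ (z : E n) (‖q‖ • EuclideanSpace.single j (1 : ℝ)) ^ 2
      ∂sphereUniform n = ∫ z, inner ℝ (z : E n) q ^ 2 ∂sphereUniform n := fun j => by
    have hnorm : ‖q‖ = ‖‖q‖ • EuclideanSpace.single j (1 : ℝ)‖ := by simp [norm_smul]
    -- Vectors of equal norm are exchanged by a reflection, so `q` may be replaced by `‖q‖ e_j` for
    -- each `j`. Summing over `j` gives `‖q‖² ‖z‖² = ‖q‖²`.
    have h := Submodule.reflection_sub hnorm
    conv_lhs => rw [← h]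
    exact integral_inner_sq_eq _ q
  have hint : ∀ v : E n, Integrable (fun z : Metric.sphere (0 : E n) 1 => inner ℝ (z : E n) v ^ 2)
      (sphereUniform n) := fun v => by
    refine Integrable.of_bound (C := ‖v‖ ^ 2)
      (Continuous.aestronglyMeasurable (by fun_prop)) (Filter.Eventually.of_forall fun z => ?_)
    have h1 := abs_real_inner_le_norm (z : E n) v
    rw [norm_eq_of_mem_sphere, one_mul] at h1
    rw [norm_pow, Real.norm_eq_abs]
    gcongr
  have hsum : ∑ j : Fin n, ∫ z, inner ℝ (z : E n) (‖q‖ • EuclideanSpace.single j (1 : ℝ)) ^ 2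
      ∂sphereUniform n = ‖q‖ ^ 2 := by
    rw [← integral_finsetSum _ (fun j _ => hint _)]
    have : ∀ z : Metric.sphere (0 : E n) 1,
        ∑ j : Fin n, inner ℝ (z : E n) (‖q‖ • EuclideanSpace.single j (1 : ℝ)) ^ 2 = ‖q‖ ^ 2 := by
      intro z
      have hz : ‖(z : E n)‖ ^ 2 = 1 := by simp
      rw [EuclideanSpace.norm_sq_eq] at hz
      simp only [inner_smul_right, EuclideanSpace.inner_single_right, mul_pow, conj_trivial,
        one_mul]
      rw [← Finset.mul_sum]
      simp only [Real.norm_eq_abs, sq_abs] at hz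
      rw [hz, mul_one]
    simp [this]
  simp only [key, Finset.sum_const, Finset.card_univ, Fintype.card_fin, nsmul_eq_mul] at hsum
  have hn0 : (n : ℝ) ≠ 0 := by positivity
  field_simp
  linarith

/-- Reflection of the sphere in the hyperplane orthogonal to `q`. -/
theorem reflection_orthogonal_singleton_apply (q z : E n) :
    (Submodule.span ℝ {q})ᗮ.reflection z = z - (2 * inner ℝ z q / ‖q‖ ^ 2) • q := by
  rw [Submodule.reflection_orthogonal_apply, Submodule.reflection_singleton_apply,
    real_inner_comm]
  simp only [RCLike.ofReal_real_eq_id, id]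
  module

end Sphere

section Round

/-! ### One round of the algorithm -/

variable {N : ℕ} {d : Fin N → ℕ}

/-- Joint perturbation directions. -/
abbrev Directions (d : Fin N → ℕ) : Type := (i : Fin N) → Metric.sphere (0 : E (d i)) 1

/-- Joint perturbation directions as vectors. -/
def Directions.toProfile (z : Directions d) : Profile d := fun i => (z i : E (d i))

theorem Directions.continuous_toProfile :
    Continuous (Directions.toProfile : Directions d → Profile d) :=
  continuous_pi fun i => continuous_subtype_val.comp (continuous_apply i)

theorem Directions.norm_toProfile (z : Directions d) (i : Fin N) : ‖z.toProfile i‖ = 1 := by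
  simp [Directions.toProfile]

/-- The joint uniform distribution of the directions of one round. -/
def directionLaw (d : Fin N → ℕ) : Measure (Directions d) :=
  Measure.pi fun i => sphereUniform (d i)

theorem isProbabilityMeasure_directionLaw (hd : ∀ i, 1 ≤ d i) :
    IsProbabilityMeasure (directionLaw d) := by
  have := fun i => isProbabilityMeasure_sphereUniform (hd i)
  unfold directionLaw
  infer_instance

/-! ### Interior actions and first-order expansion of payoffs -/

namespace SmoothConcaveGame

variable (G : SmoothConcaveGame N d)

/-- Joint actions all of whose components are interior. -/
def interiorActions : Set (Profile d) := Set.univ.pi fun i => interior (G.X i)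

variable {G}

theorem mem_interiorActions {x : Profile d} :
    x ∈ G.interiorActions ↔ ∀ i, x i ∈ interior (G.X i) := by
  simp [interiorActions]

theorem mem_actions {x : Profile d} : x ∈ G.actions ↔ ∀ i, x i ∈ G.X i := by
  simp [actions]

theorem interiorActions_subset : G.interiorActions ⊆ G.actions :=
  Set.pi_mono fun _ _ => interior_subset

theorem update_mem_actions {x : Profile d} (hx : x ∈ G.actions) {i : Fin N} {y : E (d i)}
    (hy : y ∈ G.X i) : Function.update x i y ∈ G.actions := by
  rw [mem_actions] at *
  intro j
  rcases eq_or_ne j i with rfl | hj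
  · simpa using hy
  · simpa [hj] using hx j

theorem v_update (i : Fin N) (x : Profile d) (y : E (d i)) :
    G.v i (Function.update x i y) =
      gradientWithin (fun y' => G.u i (Function.update x i y')) (G.X i) y := by
  simp [v, payoffGrad]

theorem exists_lipschitz (G : SmoothConcaveGame N d) : ∃ ℓ : Fin N → ℝ, (∀ i, 0 ≤ ℓ i) ∧
    ∀ i, ∀ x ∈ G.actions, ∀ x' ∈ G.actions, ‖G.v i x - G.v i x'‖ ≤ ℓ i * √(sqDist x x') := by
  choose ℓ hℓ using G.lipschitz_grad
  exact ⟨fun i => |ℓ i|, fun i => abs_nonneg _, fun i x hx x' hx' =>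
    (hℓ i x hx x' hx').trans (by gcongr; exact le_abs_self _)⟩

/-- First-order expansion of a payoff in the player's own action around a nearby joint action. -/
theorem abs_u_sub_le {i : Fin N} {ℓ : ℝ} (hℓ0 : 0 ≤ ℓ)
    (hℓ : ∀ x ∈ G.actions, ∀ x' ∈ G.actions, ‖G.v i x - G.v i x'‖ ≤ ℓ * √(sqDist x x'))
    {x Y : Profile d} (hx : x ∈ G.actions) (hY : Y ∈ G.actions) {a : E (d i)} (ha : a ∈ G.X i)
    {r : Fin N → ℝ} (hr : ∀ j, ‖Y j - x j‖ ^ 2 ≤ r j) (har : ‖a - x i‖ ^ 2 ≤ r i) :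
    |G.u i Y - G.u i (Function.update Y i a) - inner ℝ (G.v i x) (Y i - a)| ≤
      ℓ * √(∑ j, r j) * ‖Y i - a‖ := by
  have hri : 0 ≤ r i := (sq_nonneg _).trans har
  have hmem : ∀ y : E (d i), ‖y - x i‖ ^ 2 ≤ r i → y ∈ Metric.closedBall (x i) (√(r i)) :=
    fun y hy => by
      rw [Metric.mem_closedBall, dist_eq_norm]; exact Real.le_sqrt_of_sq_le hy
  -- Mean value inequality on the convex set of own actions within `√(r i)` of `x i`; there the
  -- payoff gradient differs from `v_i(x)` by at most `ℓ √(∑ r j)`.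
  have key := ((G.convex_X i).inter (convex_closedBall (x i) (√(r i)))
    ).norm_image_sub_le_of_norm_hasFDerivWithin_le' (𝕜 := ℝ)
    (f := fun y => G.u i (Function.update Y i y))
    (f' := fun y => InnerProductSpace.toDual ℝ (E (d i)) (G.v i (Function.update Y i y)))
    (φ := InnerProductSpace.toDual ℝ (E (d i)) (G.v i x))
    (C := ℓ * √(∑ j, r j)) (x := a) (y := Y i) ?_ ?_ ⟨ha, hmem a har⟩
    ⟨mem_actions.1 hY i, hmem _ (hr i)⟩
  · simpa using key
  · intro y hy
    rw [v_update, toDual_gradientWithin]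
    exact ((G.differentiableOn_u i Y hY) y hy.1).hasFDerivWithinAt.mono Set.inter_subset_left
  · intro y hy
    rw [← map_sub, LinearIsometryEquiv.norm_map]
    refine (hℓ _ (update_mem_actions hY hy.1) x hx).trans ?_
    gcongr
    unfold sqDist
    refine Finset.sum_le_sum fun j _ => ?_
    rcases eq_or_ne j i with rfl | hj
    · have := hy.2
      rw [Metric.mem_closedBall, dist_eq_norm] at this
      rw [Function.update_self]
      calc _ ≤ (√(r j)) ^ 2 := by gcongr
        _ = r j := Real.sq_sqrt hri
    · simpa [hj] using hr j

end SmoothConcaveGame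

/-! ### Feasibility, continuity, bias and mirror step of a single round -/

section OneRound

variable {G : SmoothConcaveGame N d} {R : (i : Fin N) → E (d i) → ℝ} {ν : Fin N → ℝ}
  {lam : Fin N → ℝ} {β : ℝ} {η : ℕ → ℝ} {t : ℕ}

theorem play_mem (hR : ∀ i, IsSelfConcordantBarrier (G.X i) (ν i) (R i))
    (hc : ∀ i, 0 < coeff lam β η t i) {x : Profile d} (hx : x ∈ G.interiorActions)
    {z : Profile d} (hz : ∀ i, ‖z i‖ = 1) : play R lam β η t x z ∈ G.interiorActions := by
  rw [SmoothConcaveGame.mem_interiorActions] at *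
  exact fun i => (hR i).add_scaling_mem (hc i) (hx i) (hz i)

theorem norm_play_sub_sq_le (hR : ∀ i, IsSelfConcordantBarrier (G.X i) (ν i) (R i))
    (hc : ∀ i, 0 < coeff lam β η t i) {x : Profile d} (hx : x ∈ G.interiorActions)
    {z : Profile d} (hz : ∀ i, ‖z i‖ = 1) (i : Fin N) :
    ‖play R lam β η t x z i - x i‖ ^ 2 ≤ 1 / coeff lam β η t i := by
  have := (hR i).norm_scaling_sq_le (hc i) (SmoothConcaveGame.mem_interiorActions.1 hx i) (z i)
  rw [hz, one_pow] at this
  simpa [play, scalingAt] using this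

/-- The directions, and pivots, of an actual round. -/
def roundDomain (G : SmoothConcaveGame N d) : Set (Profile d × Profile d) :=
  {p | p.1 ∈ G.interiorActions ∧ ∀ i, ‖p.2 i‖ = 1}

theorem continuousOn_fst_apply (i : Fin N) :
    ContinuousOn (fun p : Profile d × Profile d => p.1 i) (roundDomain G) :=
  ((continuous_apply i).comp continuous_fst).continuousOn

theorem continuousOn_snd_apply (i : Fin N) :
    ContinuousOn (fun p : Profile d × Profile d => p.2 i) (roundDomain G) :=
  ((continuous_apply i).comp continuous_snd).continuousOn

theorem continuousOn_play (hR : ∀ i, IsSelfConcordantBarrier (G.X i) (ν i) (R i))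
    (hc : ∀ i, 0 < coeff lam β η t i) :
    ContinuousOn (fun p : Profile d × Profile d => play R lam β η t p.1 p.2) (roundDomain G) := by
  refine continuousOn_pi.2 fun i => (continuousOn_fst_apply i).add ?_
  exact ContinuousOn.toEuclideanLin_apply
    (((hR i).continuousOn_scaling (hc i)).comp (continuousOn_fst_apply i)
      fun p hp => SmoothConcaveGame.mem_interiorActions.1 hp.1 i) (continuousOn_snd_apply i)

theorem continuousOn_gradEst (hR : ∀ i, IsSelfConcordantBarrier (G.X i) (ν i) (R i))
    (hc : ∀ i, 0 < coeff lam β η t i) (i : Fin N) :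
    ContinuousOn (fun p : Profile d × Profile d => gradEst G R lam β η t p.1 p.2 i)
      (roundDomain G) := by
  refine ContinuousOn.smul (f := fun p : Profile d × Profile d =>
    (d i * G.u i (play R lam β η t p.1 p.2))) (continuousOn_const.mul ?_) ?_
  · exact (G.continuousOn_u i).comp (continuousOn_play hR hc) fun p hp =>
      SmoothConcaveGame.interiorActions_subset (play_mem hR hc hp.1 hp.2)
  · exact ContinuousOn.toEuclideanLin_apply
      (((hR i).continuousOn_inv_scaling (hc i)).comp (continuousOn_fst_apply i)
        fun p hp => SmoothConcaveGame.mem_interiorActions.1 hp.1 i) (continuousOn_snd_apply i)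

/-- As `A⁻¹` is symmetric, it can be moved onto `h`. The estimate then depends on the direction only
through the payoff and `⟨z_i, A⁻¹h⟩`. -/
theorem inner_gradEst (x z : Profile d) (i : Fin N) (h : E (d i)) :
    inner ℝ (gradEst G R lam β η t x z i) h = d i * G.u i (play R lam β η t x z) *
      inner ℝ (z i) (Matrix.toEuclideanLin (scalingAt R lam β η t x i)⁻¹ h) := by
  rw [gradEst, inner_smul_left, scalingAt, IsSelfConcordantBarrier.inner_inv_scaling]
  simp

theorem mem_roundDomain {x : Profile d} (hx : x ∈ G.interiorActions) (z : Directions d) :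
    (x, z.toProfile) ∈ roundDomain G := ⟨hx, z.norm_toProfile⟩

theorem continuous_inner_gradEst (hR : ∀ i, IsSelfConcordantBarrier (G.X i) (ν i) (R i))
    (hc : ∀ i, 0 < coeff lam β η t i) {x : Profile d} (hx : x ∈ G.interiorActions) (i : Fin N)
    (h : E (d i)) :
    Continuous fun z : Directions d => inner ℝ (gradEst G R lam β η t x z.toProfile i) h := by
  have := (continuousOn_gradEst (t := t) hR hc i).comp_continuous
    (f := fun z : Directions d => (x, z.toProfile))
    (continuous_const.prodMk Directions.continuous_toProfile) (fun z => mem_roundDomain hx z)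
  exact this.inner continuous_const

theorem integrable_of_continuous (hd : ∀ i, 1 ≤ d i) {f : Directions d → ℝ} (hf : Continuous f) :
    Integrable f (directionLaw d) := by
  have := isProbabilityMeasure_directionLaw hd
  exact hf.integrable_of_hasCompactSupport (HasCompactSupport.of_compactSpace f)

theorem integral_inner_sq_directionLaw (hd : ∀ i, 1 ≤ d i) (i : Fin N) (q : E (d i)) :
    ∫ z, inner ℝ (z i : E (d i)) q ^ 2 ∂directionLaw d = ‖q‖ ^ 2 / d i := by
  have := fun i => isProbabilityMeasure_sphereUniform (hd i)
  rw [← integral_inner_sq (hd i), ← (measurePreserving_eval (fun i => sphereUniform (d i))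
    i).map_eq, integral_map (measurable_pi_apply i).aemeasurable
    (Continuous.aestronglyMeasurable (by fun_prop))]
  rfl

/-- Reflecting one player's direction preserves the law of the directions. -/
theorem exists_reflection (hd : ∀ i, 1 ≤ d i) (i : Fin N) (q : E (d i)) :
    ∃ ρ : Directions d → Directions d,
      MeasurePreserving ρ (directionLaw d) (directionLaw d) ∧ Continuous ρ ∧
      (∀ z, ∀ j, j ≠ i → ρ z j = z j) ∧
      ∀ z, (ρ z i : E (d i)) = (z i : E (d i)) - (2 * inner ℝ (z i : E (d i)) q / ‖q‖ ^ 2) • q := by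
  have := fun i => isProbabilityMeasure_sphereUniform (hd i)
  let fs : (j : Fin N) → E (d j) ≃ₗᵢ[ℝ] E (d j) :=
    Function.update (fun j => LinearIsometryEquiv.refl ℝ (E (d j))) i
      (Submodule.span ℝ {q})ᗮ.reflection
  refine ⟨fun z j => sphereMap (fs j) (z j), measurePreserving_pi _ _
    fun j => measurePreserving_sphereMap (fs j), ?_, ?_, ?_⟩
  · refine continuous_pi fun j => ?_
    exact ((fs j).continuous.comp (continuous_subtype_val.comp (continuous_apply j))).subtype_mk _
  · intro z j hj
    ext1
    simp [sphereMap, fs, hj]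
  · intro z
    simp [sphereMap, fs, reflection_orthogonal_singleton_apply]

/-- The bias of the gradient estimate. -/
theorem abs_integral_inner_gradEst_sub_le (hd : ∀ i, 1 ≤ d i)
    (hR : ∀ i, IsSelfConcordantBarrier (G.X i) (ν i) (R i))
    (hc : ∀ i, 0 < coeff lam β η t i) {x : Profile d} (hx : x ∈ G.interiorActions) {i : Fin N}
    {ℓ : ℝ} (hℓ0 : 0 ≤ ℓ)
    (hℓ : ∀ x ∈ G.actions, ∀ x' ∈ G.actions, ‖G.v i x - G.v i x'‖ ≤ ℓ * √(sqDist x x'))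
    (h : E (d i)) :
    |∫ z, inner ℝ (gradEst G R lam β η t x z.toProfile i) h ∂directionLaw d -
      inner ℝ (G.v i x) h| ≤ ℓ * √(∑ j, 1 / coeff lam β η t j) * ‖h‖ := by
  rcases eq_or_ne h 0 with rfl | h0
  · simp
  have hxi := SmoothConcaveGame.mem_interiorActions.1 hx i
  set A := Matrix.toEuclideanLin (scalingAt R lam β η t x i) with hA
  set q := Matrix.toEuclideanLin (scalingAt R lam β η t x i)⁻¹ h with hq
  have hAq : A q = h := (hR i).scaling_inv_scaling (hc i) hxi h
  have hq0 : 0 < ‖q‖ := norm_pos_iff.2 fun hz => h0 (by rw [← hAq, hz, map_zero])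
  obtain ⟨ρ, hρ, hρc, hρne, hρi⟩ := exists_reflection hd i q
  set F := fun z : Directions d => inner ℝ (gradEst G R lam β η t x z.toProfile i) h with hF
  have hFc : Continuous F := continuous_inner_gradEst hR hc hx i h
  have hFint := integrable_of_continuous hd hFc
  have hFρint : Integrable (fun z => F (ρ z)) _ := integrable_of_continuous hd (hFc.comp hρc)
  -- Symmetrize over the reflection `ρ`, which preserves the law and flips the sign of `⟨z_i, q⟩`.
  -- This turns payoff values into payoff differences.
  have hsymm : ∫ z, F z ∂directionLaw d =
      ∫ z, (F z + F (ρ z)) / 2 ∂directionLaw d := by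
    have h1 : ∫ z, F (ρ z) ∂directionLaw d = ∫ z, F z ∂directionLaw d := by
      conv_rhs => rw [← hρ.map_eq]
      rw [integral_map hρ.measurable.aemeasurable hFc.aestronglyMeasurable]
    rw [integral_div, integral_add hFint hFρint, h1]
    ring
  set W := fun z : Directions d => inner ℝ (z i : E (d i)) q ^ 2 with hW
  have hWc : Continuous W := by fun_prop
  have hWint := integrable_of_continuous hd hWc
  set a := inner ℝ (G.v i x) h with ha
  set B := ℓ * √(∑ j, 1 / coeff lam β η t j) * ‖h‖ with hB
  have hdi : (0 : ℝ) < d i := by exact_mod_cast hd i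
  -- With `s = ⟨z_i, q⟩`, the two plays differ by `(2s/‖q‖²) h` in the component of player `i` only.
  -- The symmetrized estimate is `d_i s/2` times a payoff difference close to `(2s/‖q‖²) a`, hence
  -- close to `d_i a s²/‖q‖²`.
  have hpt : ∀ z, |(F z + F (ρ z)) / 2 - d i * a / ‖q‖ ^ 2 * W z| ≤
      d i * B / ‖q‖ ^ 2 * W z := by
    intro z
    set s := inner ℝ (z i : E (d i)) q with hs
    have hYmem := play_mem hR hc hx z.norm_toProfile
    have hY'mem := play_mem hR hc hx (ρ z).norm_toProfile
    set Y := play R lam β η t x z.toProfile with hY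
    have hsρ : inner ℝ (ρ z i : E (d i)) q = -s := by
      rw [hρi, inner_sub_left, inner_smul_left, real_inner_self_eq_norm_sq, ← hs]
      simp only [RCLike.conj_to_real]
      field_simp
      ring
    have hAρ : A (ρ z i : E (d i)) = A (z i : E (d i)) - (2 * s / ‖q‖ ^ 2) • h := by
      rw [hρi, map_sub, map_smul, hAq]
    have hupd : play R lam β η t x (ρ z).toProfile =
        Function.update Y i (x i + A (ρ z i : E (d i))) := by
      funext j
      rcases eq_or_ne j i with rfl | hj
      · simp [play, Directions.toProfile, hA]
      · simp [play, Directions.toProfile, hY, hj, hρne z j hj]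
    have hai : x i + A (ρ z i : E (d i)) ∈ G.X i := by
      have := SmoothConcaveGame.mem_interiorActions.1 hY'mem i
      rw [hupd, Function.update_self] at this
      exact interior_subset this
    have hexp := SmoothConcaveGame.abs_u_sub_le hℓ0 hℓ
      (SmoothConcaveGame.interiorActions_subset hx)
      (SmoothConcaveGame.interiorActions_subset hYmem) hai
      (fun j => norm_play_sub_sq_le hR hc hx z.norm_toProfile j)
      (by
        have := norm_play_sub_sq_le hR hc hx (ρ z).norm_toProfile i
        rwa [hupd, Function.update_self] at this)
    have hdiff : Y i - (x i + A (ρ z i : E (d i))) = (2 * s / ‖q‖ ^ 2) • h := by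
      rw [hAρ]
      simp only [hY, play, Directions.toProfile, hA]
      module
    rw [hdiff, ← hupd, inner_smul_right, norm_smul, ← ha] at hexp
    have hF1 : F z = d i * G.u i Y * s := inner_gradEst _ _ _ _
    have hF2 : F (ρ z) = d i * G.u i (play R lam β η t x (ρ z).toProfile) * (-s) := by
      rw [← hsρ]; exact inner_gradEst _ _ _ _
    set D := G.u i Y - G.u i (play R lam β η t x (ρ z).toProfile) with hD
    have e1 : (F z + F (ρ z)) / 2 - d i * a / ‖q‖ ^ 2 * W z =
        d i / 2 * s * (D - 2 * s / ‖q‖ ^ 2 * a) := by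
      rw [hF1, hF2, hD]
      simp only [hW, ← hs]
      field_simp
      ring
    rw [e1, abs_mul, abs_mul, abs_of_pos (by positivity : (0 : ℝ) < d i / 2)]
    calc _ ≤ d i / 2 * |s| * (ℓ * √(∑ j, 1 / coeff lam β η t j) * (‖2 * s / ‖q‖ ^ 2‖ * ‖h‖)) := by
          gcongr
      _ = d i * B / ‖q‖ ^ 2 * W z := by
          have : ‖2 * s / ‖q‖ ^ 2‖ = 2 * |s| / ‖q‖ ^ 2 := by
            rw [Real.norm_eq_abs, abs_div, abs_mul, abs_of_pos (by positivity : (0 : ℝ) < ‖q‖ ^ 2)]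
            simp
          rw [this]
          simp only [hW, ← hs, hB]
          rw [← sq_abs s]
          ring
  -- The isotropic second moment cancels `d_i / ‖q‖²` exactly, leaving `a` as the mean and `B` as
  -- the error.
  have hWval : ∫ z, W z ∂directionLaw d = ‖q‖ ^ 2 / d i := integral_inner_sq_directionLaw hd i q
  have hSint : Integrable (fun z => (F z + F (ρ z)) / 2) (directionLaw d) :=
    (hFint.add hFρint).div_const 2
  have ha' : a = ∫ z, d i * a / ‖q‖ ^ 2 * W z ∂directionLaw d := by
    rw [integral_const_mul, hWval]; field_simp
  have hB' : B = ∫ z, d i * B / ‖q‖ ^ 2 * W z ∂directionLaw d := by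
    rw [integral_const_mul, hWval]; field_simp
  rw [hsymm, ha', ← integral_sub hSint (hWint.const_mul _), hB']
  exact (abs_integral_le_integral_abs).trans
    (integral_mono (hSint.sub (hWint.const_mul _)).abs (hWint.const_mul _) hpt)

/-- The pivot of the next round. -/
def nextPivot (G : SmoothConcaveGame N d) (R : (i : Fin N) → E (d i) → ℝ) (lam : Fin N → ℝ)
    (β : ℝ) (η : ℕ → ℝ) (t : ℕ) (x z : Profile d) : Profile d := fun i =>
  prox (G.X i) (R i) (η t) (coeff lam β η t i) (x i) (gradEst G R lam β η t x z i)

theorem nextPivot_mem (hR : ∀ i, IsSelfConcordantBarrier (G.X i) (ν i) (R i)) {x : Profile d}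
    (hx : x ∈ G.interiorActions) (z : Profile d) :
    nextPivot G R lam β η t x z ∈ G.interiorActions := by
  rw [SmoothConcaveGame.mem_interiorActions] at *
  exact fun i => ((hR i).prox_spec (G.compact_X i) _ _ (hx i) _).1

/-- By strong monotonicity, the solution of the first-order condition is `c⁻¹`-Lipschitz in its
right-hand side `g`, which is continuous in the data. -/
theorem IsSelfConcordantBarrier.continuousOn_prox {n : ℕ} {X : Set (E n)} {ν : ℝ} {R : E n → ℝ}
    (hb : IsSelfConcordantBarrier X ν R) (hXc : IsCompact X) (hX : Convex ℝ X) {η c : ℝ}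
    (hc : 0 < c) {α : Type*} [TopologicalSpace α] {S : Set α} {x w : α → E n}
    (hx : ContinuousOn x S) (hw : ContinuousOn w S) (hxS : ∀ a ∈ S, x a ∈ interior X) :
    ContinuousOn (fun a => prox X R η c (x a) (w a)) S := by
  set g := fun a => gradient R (x a) + c • x a + η • w a with hg
  have hgc : ContinuousOn g S :=
    ((hb.continuousOn_gradient.comp hx hxS).add (hx.const_smul c)).add (hw.const_smul η)
  have hlip : ∀ a ∈ S, ∀ b ∈ S, ‖prox X R η c (x a) (w a) - prox X R η c (x b) (w b)‖ ≤
      c⁻¹ * ‖g a - g b‖ := by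
    intro a ha b hb'
    obtain ⟨h1, h2⟩ := hb.prox_spec hXc η c (hxS a ha) (w a)
    obtain ⟨h3, h4⟩ := hb.prox_spec hXc η c (hxS b hb') (w b)
    have h5 := hb.gradient_strongly_monotone hX (c := c) h1 h3
    rw [h2, h4] at h5
    have h6 := h5.trans (real_inner_le_norm _ _)
    set D := ‖prox X R η c (x a) (w a) - prox X R η c (x b) (w b)‖
    rw [inv_mul_eq_div, le_div_iff₀ hc]
    have hD : 0 ≤ D := norm_nonneg _
    rcases hD.eq_or_lt with h0 | h0
    · rw [← h0, zero_mul]; exact norm_nonneg _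
    · have : D * c * D ≤ ‖g a - g b‖ * D := by nlinarith
      exact le_of_mul_le_mul_right this h0
  intro a ha
  rw [ContinuousWithinAt, tendsto_iff_norm_sub_tendsto_zero]
  have h0 : Filter.Tendsto (fun b => c⁻¹ * ‖g b - g a‖) (nhdsWithin a S) (nhds 0) := by
    simpa using (tendsto_iff_norm_sub_tendsto_zero.1 (hgc a ha)).const_mul c⁻¹
  refine squeeze_zero' (Filter.Eventually.of_forall fun _ => norm_nonneg _) ?_ h0
  filter_upwards [self_mem_nhdsWithin] with b hb' using hlip b hb' a ha

theorem continuousOn_nextPivot (hR : ∀ i, IsSelfConcordantBarrier (G.X i) (ν i) (R i))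
    (hc : ∀ i, 0 < coeff lam β η t i) :
    ContinuousOn (fun p : Profile d × Profile d => nextPivot G R lam β η t p.1 p.2)
      (roundDomain G) :=
  continuousOn_pi.2 fun i => (hR i).continuousOn_prox (G.compact_X i) (G.convex_X i) (hc i)
    (continuousOn_fst_apply i) (continuousOn_gradEst hR hc i)
    fun _ hp => SmoothConcaveGame.mem_interiorActions.1 hp.1 i

/-- The mirror step inequality for one player. -/
theorem bregman_nextPivot_le (hR : ∀ i, IsSelfConcordantBarrier (G.X i) (ν i) (R i))
    (hc : ∀ i, 0 < coeff lam β η t i) {L : ℝ} (hL : ∀ i, ∀ x ∈ G.actions, |G.u i x| ≤ L)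
    (hη : 0 ≤ η t) {i : Fin N} (hηL : η t * d i * L ≤ 1 / 2) {x z : Profile d}
    (hx : x ∈ G.interiorActions) (hz : ∀ i, ‖z i‖ = 1) (p : E (d i)) :
    bregman (R i) p (nextPivot G R lam β η t x z i) +
        coeff lam β η t i / 2 * ‖p - nextPivot G R lam β η t x z i‖ ^ 2 ≤
      bregman (R i) p (x i) + coeff lam β η t i / 2 * ‖p - x i‖ ^ 2 +
        η t * inner ℝ (gradEst G R lam β η t x z i) (x i - p) + 2 * (η t * d i * L) ^ 2 := by
  have hxi := SmoothConcaveGame.mem_interiorActions.1 hx i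
  refine (hR i).prox_descent (G.compact_X i) (G.convex_X i) (hc i) hηL hxi fun h => ?_
  -- The dual norm bound: both sides are expressed through `q = A⁻¹h`, and Cauchy-Schwarz with a
  -- unit direction and `|u_i| ≤ L` gives the constant `η d_i L`.
  rw [inner_gradEst, ← (hR i).norm_inv_scaling_sq (hc i) hxi, Real.sqrt_sq (norm_nonneg _)]
  change _ ≤ _ * ‖Matrix.toEuclideanLin (scalingAt R lam β η t x i)⁻¹ h‖
  set q := Matrix.toEuclideanLin (scalingAt R lam β η t x i)⁻¹ h
  have hu := hL i _ (SmoothConcaveGame.interiorActions_subset (play_mem hR hc hx hz))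
  have h1 := abs_real_inner_le_norm (z i) q
  rw [hz, one_mul] at h1
  have h2 : G.u i (play R lam β η t x z) * inner ℝ (z i) q ≤ L * ‖q‖ := by
    refine (le_abs_self _).trans ?_
    rw [abs_mul]
    exact mul_le_mul hu h1 (abs_nonneg _) ((abs_nonneg _).trans hu)
  calc _ = η t * d i * (G.u i (play R lam β η t x z) * inner ℝ (z i) q) := by ring
    _ ≤ η t * d i * (L * ‖q‖) := by gcongr
    _ = _ := by ring

end OneRound

end Round

section Pivots

/-! ### The random pivots -/

theorem ContinuousOn.measurable_comp_of_forall_mem {Ω α γ : Type*} [MeasurableSpace Ω]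
    [TopologicalSpace α] [MeasurableSpace α] [OpensMeasurableSpace α] [TopologicalSpace γ]
    [MeasurableSpace γ] [BorelSpace γ] {F : α → γ} {S : Set α} (hF : ContinuousOn F S)
    {f : Ω → α} (hf : Measurable f) (hfS : ∀ ω, f ω ∈ S) : Measurable fun ω => F (f ω) :=
  (continuousOn_iff_continuous_domRestrict.1 hF).measurable.comp (hf.subtype_mk (h := hfS))

variable {N : ℕ} {d : Fin N → ℕ} {G : SmoothConcaveGame N d} {R : (i : Fin N) → E (d i) → ℝ}
  {ν : Fin N → ℝ} {lam : Fin N → ℝ} {β : ℝ} {η : ℕ → ℝ} {t : ℕ}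

theorem pivot_succ (z : ℕ → Profile d) (ht : 1 ≤ t) :
    pivot G R lam β η z (t + 1) =
      nextPivot G R lam β η t (pivot G R lam β η z t) (z t) := by
  obtain ⟨t, rfl⟩ := Nat.exists_eq_add_of_le' ht
  rfl

theorem pivot_one_mem (hR : ∀ i, IsSelfConcordantBarrier (G.X i) (ν i) (R i))
    (hint : ∀ i, (interior (G.X i)).Nonempty) (z : ℕ → Profile d) :
    pivot G R lam β η z 1 ∈ G.interiorActions :=
  SmoothConcaveGame.mem_interiorActions.2 fun i =>
    ((hR i).argminOn_spec (G.compact_X i) (hint i)).1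

theorem isCompact_unitDirections : IsCompact {z : Profile d | ∀ i, ‖z i‖ = 1} := by
  have : {z : Profile d | ∀ i, ‖z i‖ = 1} = Set.univ.pi fun i => Metric.sphere (0 : E (d i)) 1 := by
    ext z; simp
  rw [this]
  exact isCompact_univ_pi fun i => isCompact_sphere _ _

/-- In every round the pivots stay in a fixed compact set of interior actions. -/
theorem exists_compact_pivot_mem (hR : ∀ i, IsSelfConcordantBarrier (G.X i) (ν i) (R i))
    (hint : ∀ i, (interior (G.X i)).Nonempty)
    (hc : ∀ t, 1 ≤ t → ∀ i, 0 < coeff lam β η t i) (ht : 1 ≤ t) :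
    ∃ K : Set (Profile d), IsCompact K ∧ K ⊆ G.interiorActions ∧
      ∀ z : ℕ → Profile d, (∀ t i, ‖z t i‖ = 1) → pivot G R lam β η z t ∈ K := by
  induction t, ht using Nat.le_induction with
  | base =>
    refine ⟨{fun i => argminOn (interior (G.X i)) (R i)}, isCompact_singleton, ?_, ?_⟩
    · rw [Set.singleton_subset_iff]
      exact pivot_one_mem (lam := lam) (β := β) (η := η) hR hint (fun _ _ => 0)
    · intro z _; rfl
  | succ t ht ih =>
    obtain ⟨K, hK, hKs, hKm⟩ := ih
    have hsub : K ×ˢ {z : Profile d | ∀ i, ‖z i‖ = 1} ⊆ roundDomain G :=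
      fun p hp => ⟨hKs hp.1, hp.2⟩
    refine ⟨(fun p : Profile d × Profile d => nextPivot G R lam β η t p.1 p.2) ''
      (K ×ˢ {z : Profile d | ∀ i, ‖z i‖ = 1}), ?_, ?_, ?_⟩
    · exact (hK.prod isCompact_unitDirections).image_of_continuousOn
        ((continuousOn_nextPivot hR (hc t ht)).mono hsub)
    · rintro _ ⟨p, hp, rfl⟩
      exact nextPivot_mem hR (hKs hp.1) p.2
    · intro z hz
      rw [pivot_succ z ht]
      exact ⟨(_, z t), ⟨hKm z hz, hz t⟩, rfl⟩

/-- The pivot is a measurable function of the directions of the earlier rounds. -/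
theorem measurable_pivot {Ω : Type*} {_ : MeasurableSpace Ω}
    {z : ℕ → (i : Fin N) → Ω → Metric.sphere (0 : E (d i)) 1}
    (hR : ∀ i, IsSelfConcordantBarrier (G.X i) (ν i) (R i))
    (hint : ∀ i, (interior (G.X i)).Nonempty)
    (hc : ∀ t, 1 ≤ t → ∀ i, 0 < coeff lam β η t i) (ht : 1 ≤ t)
    (hz : ∀ s, 1 ≤ s → s < t → ∀ i, Measurable (z s i)) :
    Measurable fun ω => pivot G R lam β η (fun t i => (z t i ω : E (d i))) t := by
  induction t, ht using Nat.le_induction with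
  | base => exact measurable_const
  | succ t ht ih =>
    have h1 := ih fun s hs hst => hz s hs (hst.trans (Nat.lt_succ_self t))
    have h2 : Measurable fun ω => (fun i => (z t i ω : E (d i)) : Profile d) :=
      measurable_pi_lambda _ fun i => measurable_subtype_coe.comp (hz t ht (Nat.lt_succ_self t) i)
    obtain ⟨K, -, hKs, hKm⟩ := exists_compact_pivot_mem hR hint hc ht
    simp only [pivot_succ _ ht]
    have hmem : ∀ ω, (pivot G R lam β η (fun t i => (z t i ω : E (d i))) t,
        fun i => (z t i ω : E (d i))) ∈ roundDomain G :=
      fun ω => ⟨hKs (hKm _ fun t i => norm_eq_of_mem_sphere _), fun i => norm_eq_of_mem_sphere _⟩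
    have h3 := h1.prodMk h2
    have h4 := continuousOn_nextPivot (lam := lam) (β := β) (η := η) hR (hc t ht)
    have h5 := ContinuousOn.measurable_comp_of_forall_mem h4 h3 hmem
    exact h5

/-! ### Independence of the pivot and the directions of its round -/

section Random

variable {Ω : Type*} [mΩ : MeasurableSpace Ω] {P : Measure Ω}

/-- Averaging over the directions of a round, which are independent of its pivot. -/
theorem integral_le_integral_of_forall_integral_le [IsProbabilityMeasure P] (hd : ∀ i, 1 ≤ d i) {x : Ω → Profile d}
    {ζ : Ω → Directions d} {K : Set (Profile d)} (hK : IsCompact K)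
    (hKs : K ⊆ G.interiorActions) (hxK : ∀ ω, x ω ∈ K) (hx : Measurable x) (hζ : Measurable ζ)
    (hlaw : P.map ζ = directionLaw d) (hind : IndepFun x ζ P)
    {H : Profile d × Profile d → ℝ} (hH : ContinuousOn H (roundDomain G))
    {Φ : Profile d → ℝ} (hΦ : ContinuousOn Φ G.interiorActions)
    (hle : ∀ y ∈ G.interiorActions, ∫ ξ : Directions d, H (y, ξ.toProfile) ∂directionLaw d ≤ Φ y) :
    ∫ ω, H (x ω, (ζ ω).toProfile) ∂P ≤ ∫ ω, Φ (x ω) ∂P := by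
  have := isProbabilityMeasure_directionLaw hd
  have hKc : CompactSpace K := isCompact_iff_compactSpace.1 hK
  -- Viewed in the compact space `K`, the integrands are continuous on compact spaces, hence
  -- integrable, and Fubini applies.
  let x' : Ω → K := fun ω => ⟨x ω, hxK ω⟩
  have hx' : Measurable x' := hx.subtype_mk
  have hind' : IndepFun x' ζ P := by
    rw [IndepFun_iff_Indep] at hind ⊢
    have e : MeasurableSpace.comap x' inferInstance = MeasurableSpace.comap x inferInstance := by
      change MeasurableSpace.comap x' (MeasurableSpace.comap Subtype.val _) = _
      rw [MeasurableSpace.comap_comp]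
      rfl
    rw [e]
    exact hind
  let h : K × Directions d → ℝ := fun p => H (p.1, p.2.toProfile)
  have hh : Continuous h := by
    refine hH.comp_continuous (f := fun p : K × Directions d => ((p.1 : Profile d),
      p.2.toProfile)) ?_ fun p => ?_
    · exact (continuous_subtype_val.comp continuous_fst).prodMk
        (Directions.continuous_toProfile.comp continuous_snd)
    · exact mem_roundDomain (hKs p.1.2) p.2
  have hpx : IsProbabilityMeasure (P.map x') := Measure.isProbabilityMeasure_map hx'.aemeasurable
  have hprod : P.map (fun ω => (x' ω, ζ ω)) = (P.map x').prod (directionLaw d) := by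
    rw [(indepFun_iff_map_prod_eq_prod_map_map hx'.aemeasurable hζ.aemeasurable).1 hind', hlaw]
  have hhi : Integrable h ((P.map x').prod (directionLaw d)) :=
    hh.integrable_of_hasCompactSupport (HasCompactSupport.of_compactSpace h)
  have hΦc : Continuous fun y : K => Φ y :=
    hΦ.comp_continuous continuous_subtype_val fun y => hKs y.2
  have hΦi : Integrable (fun y : K => Φ y) (P.map x') :=
    hΦc.integrable_of_hasCompactSupport (HasCompactSupport.of_compactSpace _)
  calc ∫ ω, H (x ω, (ζ ω).toProfile) ∂P = ∫ p, h p ∂(P.map fun ω => (x' ω, ζ ω)) := by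
        rw [integral_map (hx'.prodMk hζ).aemeasurable hh.aestronglyMeasurable]
    _ = ∫ y, ∫ ξ, h (y, ξ) ∂directionLaw d ∂(P.map x') := by rw [hprod, integral_prod h hhi]
    _ ≤ ∫ y : K, Φ y ∂(P.map x') :=
        integral_mono hhi.integral_prod_left hΦi fun y => hle y (hKs y.2)
    _ = ∫ ω, Φ (x ω) ∂P := by
        rw [integral_map hx'.aemeasurable hΦc.aestronglyMeasurable]

variable {z : ℕ → (i : Fin N) → Ω → Metric.sphere (0 : E (d i)) 1}

/-- The pivot uses directions of earlier rounds only; disjoint blocks of an independent family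
generate independent σ-algebras. -/
theorem indepFun_pivot (hR : ∀ i, IsSelfConcordantBarrier (G.X i) (ν i) (R i))
    (hint : ∀ i, (interior (G.X i)).Nonempty)
    (hc : ∀ t, 1 ≤ t → ∀ i, 0 < coeff lam β η t i) (ht : 1 ≤ t)
    (hz : ∀ t, 1 ≤ t → ∀ i, Measurable (z t i))
    (hind : iIndepFun (fun (p : {t : ℕ // 1 ≤ t} × Fin N) => z p.1 p.2) P) :
    IndepFun (fun ω => pivot G R lam β η (fun t i => (z t i ω : E (d i))) t)
      (fun ω => (fun i => z t i ω : Directions d)) P := by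
  let m : {t : ℕ // 1 ≤ t} × Fin N → MeasurableSpace Ω :=
    fun p => MeasurableSpace.comap (z p.1 p.2) inferInstance
  have hm : ∀ p, m p ≤ mΩ := fun p => (hz p.1 p.1.2 p.2).comap_le
  have hdisj : Disjoint {p : {t : ℕ // 1 ≤ t} × Fin N | (p.1 : ℕ) < t} {p | (p.1 : ℕ) = t} := by
    rw [Set.disjoint_left]; intro p hp hp'; exact absurd hp' (ne_of_lt hp)
  have hI := indep_iSup_of_disjoint hm hind hdisj
  rw [IndepFun_iff_Indep]
  refine indep_of_indep_of_le_left (indep_of_indep_of_le_right hI ?_) ?_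
  · rw [← measurable_iff_comap_le]
    refine @measurable_pi_lambda _ _ _ (_) _ _ fun i => ?_
    rw [measurable_iff_comap_le]
    exact le_iSup₂_of_le (f := fun p _ => m p) (⟨⟨t, ht⟩, i⟩ : {t : ℕ // 1 ≤ t} × Fin N) rfl le_rfl
  · rw [← measurable_iff_comap_le]
    -- Measurability is applied here with respect to the σ-algebra generated by the earlier
    -- directions, not the ambient one.
    refine measurable_pivot hR hint hc ht fun s hs hst i => ?_
    rw [measurable_iff_comap_le]
    exact le_iSup₂_of_le (f := fun p _ => m p) (⟨⟨s, hs⟩, i⟩ : {t : ℕ // 1 ≤ t} × Fin N) hst le_rfl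

theorem map_directions [IsProbabilityMeasure P] (ht : 1 ≤ t)
    (hz : ∀ t, 1 ≤ t → ∀ i, Measurable (z t i) ∧ P.map (z t i) = sphereUniform (d i))
    (hind : iIndepFun (fun (p : {t : ℕ // 1 ≤ t} × Fin N) => z p.1 p.2) P) :
    P.map (fun ω => (fun i => z t i ω : Directions d)) = directionLaw d := by
  have h := hind.precomp (g := fun i : Fin N => ((⟨t, ht⟩, i) : {t : ℕ // 1 ≤ t} × Fin N))
    (fun i j hij => by simpa using hij)
  have h2 := (iIndepFun_iff_map_fun_eq_pi_map fun i => (hz t ht i).1.aemeasurable).1 h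
  refine h2.trans ?_
  unfold directionLaw
  congr 1
  funext i
  exact (hz t ht i).2

end Random

end Pivots

section Drift

/-! ### Equilibria and the expected drift -/

variable {N : ℕ} {d : Fin N → ℕ}

theorem sqDist_nonneg (x y : Profile d) : 0 ≤ sqDist x y :=
  Finset.sum_nonneg fun _ _ => sq_nonneg _

theorem sqDist_comm (x y : Profile d) : sqDist x y = sqDist y x := by
  unfold sqDist; simp only [norm_sub_rev]

theorem sqDist_le_three_mul (w x y z : Profile d) :
    sqDist w z ≤ 3 * (sqDist w x + sqDist x y + sqDist y z) := by
  unfold sqDist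
  rw [← Finset.sum_add_distrib, ← Finset.sum_add_distrib, Finset.mul_sum]
  refine Finset.sum_le_sum fun i _ => ?_
  have h1 : ‖w i - z i‖ ≤ ‖w i - x i‖ + ‖x i - y i‖ + ‖y i - z i‖ := by
    have e : w i - z i = (w i - x i) + (x i - y i) + (y i - z i) := by abel
    rw [e]; exact norm_add₃_le
  have h2 : ‖w i - z i‖ ^ 2 ≤ (‖w i - x i‖ + ‖x i - y i‖ + ‖y i - z i‖) ^ 2 := by gcongr
  nlinarith [sq_nonneg (‖w i - x i‖ - ‖x i - y i‖), sq_nonneg (‖w i - x i‖ - ‖y i - z i‖),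
    sq_nonneg (‖x i - y i‖ - ‖y i - z i‖)]

theorem continuous_sqDist_left (y : Profile d) : Continuous fun x => sqDist x y :=
  continuous_finsetSum _ fun i _ => (((continuous_apply i).sub continuous_const).norm).pow 2

/-! ### Variational inequality, uniqueness and a priori bounds -/

namespace SmoothConcaveGame

variable {G : SmoothConcaveGame N d} {lam : Fin N → ℝ} {β : ℝ}

/-- The variational inequality at a Nash equilibrium. -/
theorem IsNash.inner_v_nonpos {x : Profile d} (hx : G.IsNash x) (i : Fin N) {y : E (d i)}
    (hy : y ∈ G.X i) : inner ℝ (G.v i x) (y - x i) ≤ 0 := by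
  have hxi := mem_actions.1 hx.1 i
  have hmax : IsLocalMaxOn (fun y => G.u i (Function.update x i y)) (G.X i) (x i) := by
    filter_upwards [self_mem_nhdsWithin] with y hy
    simpa using hx.2 i y hy
  have := hmax.hasFDerivWithinAt_nonpos
    ((G.differentiableOn_u i x hx.1) (x i) hxi).hasFDerivWithinAt
    (y := y - x i) (sub_mem_posTangentConeAt_of_segment_subset
      ((G.convex_X i).segment_subset hxi hy))
  rwa [← inner_gradientWithin_left] at this

/-- The variational inequality at each equilibrium, tested with the other, makes the monotonicity
sum nonnegative, while strong monotonicity bounds it by `-β` times the squared distance. -/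
theorem IsNash.eq (hmono : G.IsStronglyMonotone lam β) {x y : Profile d} (hx : G.IsNash x)
    (hy : G.IsNash y) : y = x := by
  obtain ⟨hβ, hlam, hm⟩ := hmono
  have h1 := hm x hx.1 y hy.1
  have h2 : 0 ≤ ∑ i, lam i * inner ℝ (y i - x i) (G.v i y - G.v i x) := by
    refine Finset.sum_nonneg fun i _ => mul_nonneg (hlam i).le ?_
    have h3 := hx.inner_v_nonpos i (mem_actions.1 hy.1 i)
    have h4 := hy.inner_v_nonpos i (mem_actions.1 hx.1 i)
    have e : inner ℝ (G.v i y) (x i - y i) = -inner ℝ (G.v i y) (y i - x i) := by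
      rw [← inner_neg_right, neg_sub]
    rw [real_inner_comm, inner_sub_left]
    linarith
  have h5 : sqDist x y = 0 := by
    have := sqDist_nonneg x y
    nlinarith
  funext i
  have h6 := (Finset.sum_eq_zero_iff_of_nonneg fun i _ => sq_nonneg _).1 h5 i (Finset.mem_univ i)
  rw [sq_eq_zero_iff, norm_eq_zero, sub_eq_zero] at h6
  exact h6.symm

/-- The payoff bound is positive, as strong monotonicity excludes constant payoffs. -/
theorem payoff_bound_pos (hd : ∀ i, 1 ≤ d i) (hint : ∀ i, (interior (G.X i)).Nonempty)
    (hmono : G.IsStronglyMonotone lam β) {L : ℝ} (hL : ∀ i, ∀ x ∈ G.actions, |G.u i x| ≤ L)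
    (i₀ : Fin N) : 0 < L := by
  choose x hx using hint
  have hxa : x ∈ G.actions := mem_actions.2 fun i => interior_subset (hx i)
  by_contra! hL0
  have hu : ∀ i, ∀ y ∈ G.actions, G.u i y = 0 := fun i y hy =>
    abs_eq_zero.1 (le_antisymm ((hL i y hy).trans hL0) (abs_nonneg _))
  have hv : ∀ i, ∀ y ∈ G.actions, G.v i y = 0 := fun i y hy => by
    have h1 : Set.EqOn (fun w => G.u i (Function.update y i w)) (fun _ => 0) (G.X i) :=
      fun w hw => hu i _ (update_mem_actions hy hw)
    have h2 : fderivWithin ℝ (fun w => G.u i (Function.update y i w)) (G.X i) (y i) = 0 := by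
      rw [fderivWithin_congr h1 (h1 (mem_actions.1 hy i))]
      simp
    simp [v, payoffGrad, gradientWithin, h2]
  have : NeZero (d i₀) := ⟨by have := hd i₀; omega⟩
  obtain ⟨ε, hε, hball⟩ := Metric.mem_nhds_iff.1 (isOpen_interior.mem_nhds (hx i₀))
  obtain ⟨w, hw⟩ := exists_norm_eq (E (d i₀)) (half_pos hε).le
  have hwX : x i₀ + w ∈ G.X i₀ := interior_subset (hball (by
    rw [Metric.mem_ball, dist_eq_norm, add_sub_cancel_left, hw]; exact half_lt_self hε))
  have hm := hmono.2.2 x hxa _ (update_mem_actions hxa hwX)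
  rw [Finset.sum_eq_zero fun i _ => by
    rw [hv i _ (update_mem_actions hxa hwX), hv i _ hxa, sub_zero, inner_zero_right, mul_zero]]
    at hm
  have hpos : 0 < sqDist x (Function.update x i₀ (x i₀ + w)) := by
    refine Finset.sum_pos' (fun _ _ => sq_nonneg _) ⟨i₀, Finset.mem_univ _, ?_⟩
    rw [Function.update_self, sub_add_cancel_left, norm_neg, hw]
    positivity
  nlinarith [hmono.1]

theorem exists_diameter (G : SmoothConcaveGame N d) :
    ∃ M : ℝ, 0 ≤ M ∧ ∀ i, ∀ a ∈ G.X i, ∀ b ∈ G.X i, ‖a - b‖ ≤ M := by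
  have : ∀ i, ∃ M : ℝ, 0 ≤ M ∧ ∀ a ∈ G.X i, ∀ b ∈ G.X i, ‖a - b‖ ≤ M := fun i =>
    ⟨Metric.diam (G.X i), Metric.diam_nonneg, fun a ha b hb => by
      rw [← dist_eq_norm]; exact Metric.dist_le_diam_of_mem (G.compact_X i).isBounded ha hb⟩
  choose M hM0 hM using this
  exact ⟨∑ i, M i, Finset.sum_nonneg fun i _ => hM0 i, fun i a ha b hb =>
    (hM i a ha b hb).trans (Finset.single_le_sum (fun i _ => hM0 i) (Finset.mem_univ i))⟩

theorem sqDist_le {M : ℝ} (hM : ∀ i, ∀ a ∈ G.X i, ∀ b ∈ G.X i, ‖a - b‖ ≤ M) {x y : Profile d}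
    (hx : x ∈ G.actions) (hy : y ∈ G.actions) : sqDist x y ≤ N * M ^ 2 := by
  calc sqDist x y ≤ ∑ _i : Fin N, M ^ 2 := Finset.sum_le_sum fun i _ => by
        have := hM i _ (mem_actions.1 hx i) _ (mem_actions.1 hy i); gcongr
    _ = N * M ^ 2 := by simp

/-- The variational inequality holds up to `O(δ)` at a point `δ`-close to an equilibrium. -/
theorem IsNash.sum_inner_v_le {xstar : Profile d} (hstar : G.IsNash xstar)
    (hlam : ∀ i, 0 < lam i) {ℓ : Fin N → ℝ} (hℓ0 : ∀ i, 0 ≤ ℓ i)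
    (hℓ : ∀ i, ∀ x ∈ G.actions, ∀ x' ∈ G.actions, ‖G.v i x - G.v i x'‖ ≤ ℓ i * √(sqDist x x'))
    {M : ℝ} (hM : ∀ i, ∀ a ∈ G.X i, ∀ b ∈ G.X i, ‖a - b‖ ≤ M)
    {δ : ℝ} (hδ : 0 ≤ δ) {p : Profile d} (hp : p ∈ G.actions)
    (hpδ : ∀ i, ‖p i - xstar i‖ ≤ δ) {x : Profile d} (hx : x ∈ G.actions) :
    ∑ i, lam i * inner ℝ (G.v i p) (x i - p i) ≤
      (∑ i, lam i * (ℓ i * √N * M + ‖G.v i xstar‖)) * δ := by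
  rw [Finset.sum_mul]
  refine Finset.sum_le_sum fun i _ => ?_
  rw [mul_assoc]
  refine mul_le_mul_of_nonneg_left ?_ (hlam i).le
  have hsq : √(sqDist p xstar) ≤ √N * δ := by
    rw [← Real.sqrt_sq hδ, ← Real.sqrt_mul (Nat.cast_nonneg N)]
    refine Real.sqrt_le_sqrt ?_
    calc sqDist p xstar ≤ ∑ _i : Fin N, δ ^ 2 := Finset.sum_le_sum fun i _ => by
          have := hpδ i; gcongr
      _ = N * δ ^ 2 := by simp
  have hxp := hM i _ (mem_actions.1 hx i) _ (mem_actions.1 hp i)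
  have h1 : inner ℝ (G.v i p - G.v i xstar) (x i - p i) ≤ ℓ i * (√N * δ) * M := by
    refine (real_inner_le_norm _ _).trans ?_
    refine mul_le_mul ((hℓ i p hp xstar hstar.1).trans ?_) hxp (norm_nonneg _)
      (mul_nonneg (hℓ0 i) (by positivity))
    exact mul_le_mul_of_nonneg_left hsq (hℓ0 i)
  have h2 := hstar.inner_v_nonpos i (mem_actions.1 hx i)
  have h3 : inner ℝ (G.v i xstar) (xstar i - p i) ≤ ‖G.v i xstar‖ * δ := by
    refine (real_inner_le_norm _ _).trans ?_
    rw [norm_sub_rev]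
    exact mul_le_mul_of_nonneg_left (hpδ i) (norm_nonneg _)
  -- Replace `v_i(p)` by `v_i(x⋆)`, then `p` by `x⋆` as base point: two errors of order `δ`, and a
  -- middle term that is nonpositive at equilibrium.
  have e : inner ℝ (G.v i p) (x i - p i) = inner ℝ (G.v i p - G.v i xstar) (x i - p i) +
      inner ℝ (G.v i xstar) (x i - xstar i) + inner ℝ (G.v i xstar) (xstar i - p i) := by
    rw [inner_sub_left, add_assoc, ← inner_add_right, sub_add_sub_cancel]
    ring
  rw [e]
  linarith

end SmoothConcaveGame

variable {G : SmoothConcaveGame N d} {R : (i : Fin N) → E (d i) → ℝ} {ν : Fin N → ℝ}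
  {lam : Fin N → ℝ} {β : ℝ} {η : ℕ → ℝ} {t : ℕ}

/-- The expected drift of one round towards a point that nearly satisfies the variational
inequality. -/
theorem sum_integral_inner_gradEst_le (hd : ∀ i, 1 ≤ d i)
    (hR : ∀ i, IsSelfConcordantBarrier (G.X i) (ν i) (R i))
    (hmono : G.IsStronglyMonotone lam β) (hc : ∀ i, 0 < coeff lam β η t i)
    {ℓ : Fin N → ℝ} (hℓ0 : ∀ i, 0 ≤ ℓ i)
    (hℓ : ∀ i, ∀ x ∈ G.actions, ∀ x' ∈ G.actions, ‖G.v i x - G.v i x'‖ ≤ ℓ i * √(sqDist x x'))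
    {p : Profile d} (hp : p ∈ G.actions) {ε : ℝ}
    (hε : ∀ x ∈ G.actions, ∑ i, lam i * inner ℝ (G.v i p) (x i - p i) ≤ ε)
    {x : Profile d} (hx : x ∈ G.interiorActions) :
    ∫ z : Directions d, (∑ i, lam i *
      inner ℝ (gradEst G R lam β η t x z.toProfile i) (x i - p i)) ∂directionLaw d ≤
    -(β / 2) * sqDist x p +
      (ε + (∑ i, (lam i * ℓ i) ^ 2) / (2 * β) * ∑ j, 1 / coeff lam β η t j) := by
  obtain ⟨hβ, hlam, hm⟩ := hmono
  have hxa := SmoothConcaveGame.interiorActions_subset hx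
  set S := ∑ j, 1 / coeff lam β η t j with hS
  have hS0 : 0 ≤ S := Finset.sum_nonneg fun j _ => (one_div_pos.2 (hc j)).le
  rw [integral_finsetSum _ fun i _ => ((integrable_of_continuous hd
    (continuous_inner_gradEst hR hc hx i _)).const_mul _)]
  simp only [integral_const_mul]
  have h1 : ∀ i, lam i * ∫ z : Directions d, inner ℝ (gradEst G R lam β η t x z.toProfile i)
      (x i - p i) ∂directionLaw d ≤
      lam i * inner ℝ (x i - p i) (G.v i x - G.v i p) + lam i * inner ℝ (G.v i p) (x i - p i) +
        ((lam i * ℓ i) ^ 2 / (2 * β) * S + β / 2 * ‖x i - p i‖ ^ 2) := fun i => by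
    have hb := (abs_le.1 (abs_integral_inner_gradEst_sub_le (t := t) hd hR hc hx (hℓ0 i) (hℓ i)
      (x i - p i))).2
    rw [← hS] at hb
    have hb' := mul_le_mul_of_nonneg_left hb (hlam i).le
    have e : inner ℝ (x i - p i) (G.v i x - G.v i p) =
        inner ℝ (G.v i x) (x i - p i) - inner ℝ (G.v i p) (x i - p i) := by
      rw [real_inner_comm, inner_sub_left]
    -- Young's inequality with weight `β`: the bias is paid for by half of the strong monotonicity.
    have hyoung : lam i * (ℓ i * √S * ‖x i - p i‖) ≤
        (lam i * ℓ i) ^ 2 / (2 * β) * S + β / 2 * ‖x i - p i‖ ^ 2 := by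
      have hsq := sq_nonneg (lam i * ℓ i * √S - β * ‖x i - p i‖)
      have hss := Real.sq_sqrt hS0
      rw [div_mul_eq_mul_div, div_add' _ _ _ (by positivity), le_div_iff₀ (by positivity)]
      nlinarith
    rw [e]
    nlinarith
  refine (Finset.sum_le_sum fun i _ => h1 i).trans ?_
  rw [Finset.sum_add_distrib, Finset.sum_add_distrib, Finset.sum_add_distrib, ← Finset.mul_sum,
    ← Finset.sum_mul, ← Finset.sum_div]
  have h2 := hm p hp x hxa
  have h3 := hε x hxa
  rw [sqDist_comm] at h2
  change _ + _ + (_ + β / 2 * sqDist x p) ≤ _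
  linarith

/-- The mirror step inequality, summed over the players. -/
theorem sum_bregman_nextPivot_le (hR : ∀ i, IsSelfConcordantBarrier (G.X i) (ν i) (R i))
    (hlam : ∀ i, 0 < lam i) (hc : ∀ i, 0 < coeff lam β η t i) {L : ℝ}
    (hL : ∀ i, ∀ x ∈ G.actions, |G.u i x| ≤ L) (hη : 0 ≤ η t)
    (hηL : ∀ i, η t * d i * L ≤ 1 / 2) {x z : Profile d} (hx : x ∈ G.interiorActions)
    (hz : ∀ i, ‖z i‖ = 1) (p : Profile d) :
    (∑ i, lam i * bregman (R i) (p i) (nextPivot G R lam β η t x z i)) +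
        η t * β * (t + 1) / 2 * sqDist (nextPivot G R lam β η t x z) p ≤
      (∑ i, lam i * bregman (R i) (p i) (x i)) + η t * β * (t + 1) / 2 * sqDist x p +
        η t * (∑ i, lam i * inner ℝ (gradEst G R lam β η t x z i) (x i - p i)) +
        ∑ i, lam i * (2 * (η t * d i * L) ^ 2) := by
  unfold sqDist
  simp only [Finset.mul_sum, ← Finset.sum_add_distrib]
  refine Finset.sum_le_sum fun i _ => ?_
  have h := mul_le_mul_of_nonneg_left
    (bregman_nextPivot_le hR hc hL hη (hηL i) hx hz (p i)) (hlam i).le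
  -- The division by `λ_i` in the coefficient is undone by the weight `λ_i`, so all players share
  -- one quadratic coefficient.
  have e : coeff lam β η t i * lam i = η t * β * (t + 1) := by
    unfold coeff; have := (hlam i).ne'; field_simp
  rw [norm_sub_rev (p i), norm_sub_rev (p i)] at h
  have e1 : η t * β * (t + 1) = coeff lam β η t i * lam i := e.symm
  rw [e1]
  linarith

end Drift

section Potential

/-! ### The expected potential -/

variable {N : ℕ} {d : Fin N → ℕ} {G : SmoothConcaveGame N d} {R : (i : Fin N) → E (d i) → ℝ}
  {ν : Fin N → ℝ} {lam : Fin N → ℝ} {β : ℝ} {η : ℕ → ℝ} {t : ℕ}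

theorem continuousOn_sum_bregman (hR : ∀ i, IsSelfConcordantBarrier (G.X i) (ν i) (R i))
    (p : Profile d) :
    ContinuousOn (fun x : Profile d => ∑ i, lam i * bregman (R i) (p i) (x i))
      G.interiorActions := by
  refine continuousOn_finsetSum _ fun i _ => continuousOn_const.mul ?_
  have hx : ContinuousOn (fun x : Profile d => x i) G.interiorActions :=
    (continuous_apply i).continuousOn
  have hm : Set.MapsTo (fun x : Profile d => x i) G.interiorActions (interior (G.X i)) :=
    fun x hx => SmoothConcaveGame.mem_interiorActions.1 hx i
  exact (continuousOn_const.sub ((hR i).contDiffOn.continuousOn.comp hx hm)).sub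
    (((hR i).continuousOn_gradient.comp hx hm).inner (continuousOn_const.sub hx))

theorem sum_bregman_nonneg (hR : ∀ i, IsSelfConcordantBarrier (G.X i) (ν i) (R i))
    (hlam : ∀ i, 0 < lam i) {p x : Profile d} (hp : p ∈ G.interiorActions)
    (hx : x ∈ G.interiorActions) : 0 ≤ ∑ i, lam i * bregman (R i) (p i) (x i) :=
  Finset.sum_nonneg fun i _ => mul_nonneg (hlam i).le ((hR i).bregman_nonneg (G.convex_X i)
    (SmoothConcaveGame.mem_interiorActions.1 hx i) (SmoothConcaveGame.mem_interiorActions.1 hp i))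

theorem pivot_mem (hR : ∀ i, IsSelfConcordantBarrier (G.X i) (ν i) (R i))
    (hint : ∀ i, (interior (G.X i)).Nonempty)
    (hc : ∀ t, 1 ≤ t → ∀ i, 0 < coeff lam β η t i) (ht : 1 ≤ t) {z : ℕ → Profile d}
    (hz : ∀ t i, ‖z t i‖ = 1) : pivot G R lam β η z t ∈ G.interiorActions := by
  obtain ⟨K, -, hKs, hKm⟩ := exists_compact_pivot_mem hR hint hc ht
  exact hKs (hKm _ hz)

section Random

variable {Ω : Type*} [MeasurableSpace Ω] {P : Measure Ω} [IsProbabilityMeasure P]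
  {z : ℕ → (i : Fin N) → Ω → Metric.sphere (0 : E (d i)) 1}

theorem integral_add_mul_le {b₁ a₁ b₀ a₀ h : Ω → ℝ} {c e Q : ℝ} (hb₁ : Integrable b₁ P)
    (ha₁ : Integrable a₁ P) (hb₀ : Integrable b₀ P) (ha₀ : Integrable a₀ P) (hh : Integrable h P)
    (hle : ∀ ω, b₁ ω + c * a₁ ω ≤ b₀ ω + c * a₀ ω + (e * h ω + Q)) :
    ∫ ω, b₁ ω ∂P + c * ∫ ω, a₁ ω ∂P ≤
      ∫ ω, b₀ ω ∂P + c * ∫ ω, a₀ ω ∂P + (e * ∫ ω, h ω ∂P + Q) := by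
  have h₁ : Integrable (fun ω => b₁ ω + c * a₁ ω) P := hb₁.add (ha₁.const_mul c)
  have h₀ : Integrable (fun ω => b₀ ω + c * a₀ ω) P := hb₀.add (ha₀.const_mul c)
  have h₂ : Integrable (fun ω => e * h ω + Q) P := (hh.const_mul e).add (integrable_const Q)
  have := integral_mono h₁ (h₀.add h₂) hle
  simp only [Pi.add_apply] at this
  rw [integral_add hb₁ (ha₁.const_mul c), integral_add h₀ h₂,
    integral_add hb₀ (ha₀.const_mul c), integral_add (hh.const_mul e) (integrable_const Q),
    integral_const_mul, integral_const_mul, integral_const_mul] at this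
  simpa using this

/-- The pivot and the directions of the round lie in a compact subset of the domain of `H`, on which
`H` is bounded. -/
theorem integrable_round (hR : ∀ i, IsSelfConcordantBarrier (G.X i) (ν i) (R i))
    (hint : ∀ i, (interior (G.X i)).Nonempty)
    (hc : ∀ t, 1 ≤ t → ∀ i, 0 < coeff lam β η t i) (ht : 1 ≤ t)
    (hz : ∀ t, 1 ≤ t → ∀ i, Measurable (z t i)) {H : Profile d × Profile d → ℝ}
    (hH : ContinuousOn H (roundDomain G)) :
    Integrable (fun ω => H (pivot G R lam β η (fun t i => (z t i ω : E (d i))) t,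
      fun i => (z t i ω : E (d i)))) P := by
  obtain ⟨K, hK, hKs, hKm⟩ := exists_compact_pivot_mem hR hint hc ht
  have hsub : K ×ˢ {z : Profile d | ∀ i, ‖z i‖ = 1} ⊆ roundDomain G :=
    fun p hp => ⟨hKs hp.1, hp.2⟩
  obtain ⟨C, hC⟩ := (hK.prod isCompact_unitDirections).exists_bound_of_continuousOn (hH.mono hsub)
  have h1 := measurable_pivot hR hint hc ht fun s hs _ => hz s hs
  have h2 : Measurable fun ω => (fun i => (z t i ω : E (d i)) : Profile d) :=
    measurable_pi_lambda _ fun i => measurable_subtype_coe.comp (hz t ht i)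
  have h3 := h1.prodMk h2
  have hmem : ∀ ω, (pivot G R lam β η (fun t i => (z t i ω : E (d i))) t,
      fun i => (z t i ω : E (d i))) ∈ K ×ˢ {z : Profile d | ∀ i, ‖z i‖ = 1} :=
    fun ω => ⟨hKm _ fun t i => norm_eq_of_mem_sphere _, fun i => norm_eq_of_mem_sphere _⟩
  have h4 := ContinuousOn.measurable_comp_of_forall_mem hH h3 fun ω => hsub (hmem ω)
  exact Integrable.of_bound h4.aestronglyMeasurable C
    (Filter.Eventually.of_forall fun ω => hC _ (hmem ω))

theorem integrable_pivot (hR : ∀ i, IsSelfConcordantBarrier (G.X i) (ν i) (R i))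
    (hint : ∀ i, (interior (G.X i)).Nonempty)
    (hc : ∀ t, 1 ≤ t → ∀ i, 0 < coeff lam β η t i) (ht : 1 ≤ t)
    (hz : ∀ t, 1 ≤ t → ∀ i, Measurable (z t i)) {F : Profile d → ℝ}
    (hF : ContinuousOn F G.interiorActions) :
    Integrable (fun ω => F (pivot G R lam β η (fun t i => (z t i ω : E (d i))) t)) P :=
  integrable_round hR hint hc ht hz (H := fun p => F p.1)
    (hF.comp continuousOn_fst fun _ hp => hp.1)

/-- One round of the algorithm, in expectation. -/
theorem integral_potential_succ_le (hd : ∀ i, 1 ≤ d i)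
    (hint : ∀ i, (interior (G.X i)).Nonempty)
    (hmono : G.IsStronglyMonotone lam β) {L : ℝ} (hL : ∀ i, ∀ x ∈ G.actions, |G.u i x| ≤ L)
    (hR : ∀ i, IsSelfConcordantBarrier (G.X i) (ν i) (R i))
    (hc : ∀ t, 1 ≤ t → ∀ i, 0 < coeff lam β η t i) (ht : 1 ≤ t) (hη : 0 ≤ η t)
    (hηL : ∀ i, η t * d i * L ≤ 1 / 2)
    (hz : ∀ t, 1 ≤ t → ∀ i, Measurable (z t i) ∧ P.map (z t i) = sphereUniform (d i))
    (hind : iIndepFun (fun (p : {t : ℕ // 1 ≤ t} × Fin N) => z p.1 p.2) P)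
    {ℓ : Fin N → ℝ} (hℓ0 : ∀ i, 0 ≤ ℓ i)
    (hℓ : ∀ i, ∀ x ∈ G.actions, ∀ x' ∈ G.actions, ‖G.v i x - G.v i x'‖ ≤ ℓ i * √(sqDist x x'))
    {p : Profile d} (hp : p ∈ G.actions) {ε : ℝ}
    (hε : ∀ x ∈ G.actions, ∑ i, lam i * inner ℝ (G.v i p) (x i - p i) ≤ ε) :
    (∫ ω, ∑ i, lam i * bregman (R i) (p i)
        (pivot G R lam β η (fun t i => (z t i ω : E (d i))) (t + 1) i) ∂P) +
      η t * β * (t + 1) / 2 *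
        ∫ ω, sqDist (pivot G R lam β η (fun t i => (z t i ω : E (d i))) (t + 1)) p ∂P ≤
    (∫ ω, ∑ i, lam i * bregman (R i) (p i)
        (pivot G R lam β η (fun t i => (z t i ω : E (d i))) t i) ∂P) +
      η t * β * t / 2 *
        ∫ ω, sqDist (pivot G R lam β η (fun t i => (z t i ω : E (d i))) t) p ∂P +
      (η t * (ε + (∑ i, (lam i * ℓ i) ^ 2) / (2 * β) * ∑ j, 1 / coeff lam β η t j) +
        ∑ i, lam i * (2 * (η t * d i * L) ^ 2)) := by
  have hz1 : ∀ t, 1 ≤ t → ∀ i, Measurable (z t i) := fun t ht i => (hz t ht i).1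
  have hbc := continuousOn_sum_bregman (lam := lam) hR p
  have hsc : ContinuousOn (fun x => sqDist x p) G.interiorActions :=
    (continuous_sqDist_left p).continuousOn
  have hb : ∀ t, 1 ≤ t → Integrable (fun ω => ∑ i, lam i * bregman (R i) (p i)
      (pivot G R lam β η (fun t i => (z t i ω : E (d i))) t i)) P :=
    fun t ht => integrable_pivot hR hint hc ht hz1 hbc
  have hs : ∀ t, 1 ≤ t → Integrable (fun ω =>
      sqDist (pivot G R lam β η (fun t i => (z t i ω : E (d i))) t) p) P :=
    fun t ht => integrable_pivot hR hint hc ht hz1 hsc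
  let H : Profile d × Profile d → ℝ := fun q =>
    ∑ i, lam i * inner ℝ (gradEst G R lam β η t q.1 q.2 i) (q.1 i - p i)
  have hHc : ContinuousOn H (roundDomain G) :=
    continuousOn_finsetSum _ fun i _ => continuousOn_const.mul
      ((continuousOn_gradEst hR (hc t ht) i).inner
        ((continuousOn_fst_apply i).sub continuousOn_const))
  have hHi := integrable_round (P := P) hR hint hc ht hz1 hHc
  set e := ε + (∑ i, (lam i * ℓ i) ^ 2) / (2 * β) * ∑ j, 1 / coeff lam β η t j with he
  have hdrift : ∫ ω, H (pivot G R lam β η (fun t i => (z t i ω : E (d i))) t,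
      fun i => (z t i ω : E (d i))) ∂P ≤ ∫ ω, (-(β / 2) *
        sqDist (pivot G R lam β η (fun t i => (z t i ω : E (d i))) t) p + e) ∂P := by
    obtain ⟨K, hK, hKs, hKm⟩ := exists_compact_pivot_mem hR hint hc ht
    have hζ : Measurable fun ω => (fun i => z t i ω : Directions d) :=
      measurable_pi_lambda _ fun i => hz1 t ht i
    exact integral_le_integral_of_forall_integral_le hd hK hKs
      (fun ω => hKm _ fun t i => norm_eq_of_mem_sphere _)
      (measurable_pivot hR hint hc ht fun s hs _ => hz1 s hs) hζ (map_directions ht hz hind)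
      (indepFun_pivot hR hint hc ht hz1 hind) hHc
      (Φ := fun x => -(β / 2) * sqDist x p + e)
      ((continuousOn_const.mul hsc).add continuousOn_const)
      (fun y hy => sum_integral_inner_gradEst_le hd hR hmono (hc t ht) hℓ0 hℓ hp hε hy)
  rw [integral_add ((hs t ht).const_mul _) (integrable_const _), integral_const_mul] at hdrift
  simp only [integral_const, probReal_univ, one_smul] at hdrift
  set Q := ∑ i, lam i * (2 * (η t * d i * L) ^ 2) with hQ
  have hpt : ∀ ω, (∑ i, lam i * bregman (R i) (p i)
        (pivot G R lam β η (fun t i => (z t i ω : E (d i))) (t + 1) i)) +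
      η t * β * (t + 1) / 2 *
        sqDist (pivot G R lam β η (fun t i => (z t i ω : E (d i))) (t + 1)) p ≤
      ((∑ i, lam i * bregman (R i) (p i)
        (pivot G R lam β η (fun t i => (z t i ω : E (d i))) t i)) +
      η t * β * (t + 1) / 2 *
        sqDist (pivot G R lam β η (fun t i => (z t i ω : E (d i))) t) p) +
      (η t * H (pivot G R lam β η (fun t i => (z t i ω : E (d i))) t,
        fun i => (z t i ω : E (d i))) + Q) := fun ω => by
    rw [pivot_succ _ ht]
    have := sum_bregman_nextPivot_le hR hmono.2.1 (hc t ht) hL hη hηL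
      (pivot_mem hR hint hc ht (z := fun t i => (z t i ω : E (d i)))
        fun t i => norm_eq_of_mem_sphere _) (z := fun i => (z t i ω : E (d i)))
      (fun i => norm_eq_of_mem_sphere _) p
    linarith
  have ht1 : 1 ≤ t + 1 := by omega
  have hI := integral_add_mul_le (hb _ ht1) (hs _ ht1) (hb t ht) (hs t ht) hHi hpt
  -- The drift contributes `-η β/2` times the squared distance, which is exactly the difference
  -- between the weights `η β (t+1)/2` and `η β t/2`.
  have hd' := mul_le_mul_of_nonneg_left hdrift hη
  linarith

end Random

end Potential

/-! ### The rate of convergence -/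

/-- Telescoping, with the harmonic sum bounded by the logarithm. In the application `A` is of order
`1/T`, so `T * A` stays bounded. -/
theorem le_add_log_of_succ_le {V : ℕ → ℝ} {A C : ℝ} (hA : 0 ≤ A) (hC : 0 ≤ C)
    (hV : ∀ t, 1 ≤ t → V (t + 1) ≤ V t + (A + C / t)) {T : ℕ} (hT : 2 ≤ T) :
    V T ≤ V 1 + T * A + C * (1 + Real.log T) := by
  have key : ∀ t : ℕ, V (t + 1) ≤ V 1 + t * A + C * harmonic t := by
    intro t
    induction t with
    | zero => simp
    | succ t ih =>
      have h := hV (t + 1) (by omega)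
      rw [harmonic_succ]
      push_cast at h ⊢
      rw [div_eq_mul_inv] at h
      linarith
  obtain ⟨t, rfl⟩ : ∃ t, T = t + 1 := ⟨T - 1, by omega⟩
  have h1 := harmonic_le_one_add_log t
  have h2 : Real.log t ≤ Real.log (t + 1 : ℕ) :=
    Real.log_le_log (by exact_mod_cast (by omega : 0 < t)) (by push_cast; linarith)
  have h3 : C * (harmonic t : ℝ) ≤ C * (1 + Real.log (t + 1 : ℕ)) :=
    mul_le_mul_of_nonneg_left (by linarith) hC
  have h4 := key t
  push_cast at *
  linarith

variable {N : ℕ} {d : Fin N → ℕ} {L : ℝ} {lam : Fin N → ℝ} {β : ℝ} {t : ℕ}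

theorem stepSize_pos (hn : 0 < ∑ i, d i) (hL : 0 < L) (ht : 1 ≤ t) : 0 < stepSize d L t := by
  have h1 : (0 : ℝ) < (∑ i, d i : ℕ) := by exact_mod_cast hn
  have h2 : (0 : ℝ) < t := by exact_mod_cast ht
  unfold stepSize
  positivity

theorem stepSize_le (hn : 0 < ∑ i, d i) (hL : 0 < L) {s : ℕ} (hs : 1 ≤ s) (hst : s ≤ t) :
    stepSize d L t ≤ stepSize d L s := by
  have h1 : (0 : ℝ) < (∑ i, d i : ℕ) := by exact_mod_cast hn
  have h2 : (0 : ℝ) < s := by exact_mod_cast hs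
  unfold stepSize
  gcongr

theorem coeff_pos (hn : 0 < ∑ i, d i) (hL : 0 < L) (hβ : 0 < β) (hlam : ∀ i, 0 < lam i)
    (ht : 1 ≤ t) (i : Fin N) : 0 < coeff lam β (stepSize d L) t i := by
  have := stepSize_pos hn hL ht
  have := hlam i
  unfold coeff
  positivity

theorem sum_inv_coeff (lam : Fin N → ℝ) (β : ℝ) (η : ℕ → ℝ) (t : ℕ) :
    ∑ i, 1 / coeff lam β η t i = (∑ i, lam i) / (η t * β * (t + 1)) := by
  simp [coeff, Finset.sum_div]

theorem stepSize_mul_le (hn : 0 < ∑ i, d i) (hL : 0 < L) (ht : 1 ≤ t) (i : Fin N) :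
    stepSize d L t * d i * L ≤ 1 / (2 * √t) := by
  have h1 : (0 : ℝ) < (∑ i, d i : ℕ) := by exact_mod_cast hn
  have h2 : (0 : ℝ) < t := by exact_mod_cast ht
  have h3 : (d i : ℝ) ≤ (∑ i, d i : ℕ) := by
    exact_mod_cast Finset.single_le_sum (fun i _ => Nat.zero_le (d i)) (Finset.mem_univ i)
  have h4 : 0 < √(t : ℝ) := Real.sqrt_pos.2 h2
  have e : stepSize d L t * d i * L = d i / (∑ i, d i : ℕ) * (1 / (2 * √t)) := by
    unfold stepSize; field_simp
  rw [e]
  exact mul_le_of_le_one_left (by positivity) ((div_le_one h1).2 h3)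

/-- The final weight of the squared distance in the potential grows like `√T`; this is the source of
the rate. -/
theorem stepSize_mul_self (d : Fin N → ℕ) (L : ℝ) (t : ℕ) :
    stepSize d L t * t = √t / (2 * (∑ i, d i : ℕ) * L) := by
  unfold stepSize
  rw [one_div_mul_eq_div, div_mul_eq_div_div_swap, Real.div_sqrt]

/-- The per-round error of the potential is `O(1/t)`. -/
theorem error_le (hn : 0 < ∑ i, d i) (hL : 0 < L) (hβ : 0 < β) (hlam : ∀ i, 0 < lam i)
    {ε C : ℝ} (hε : 0 ≤ ε) (hC : 0 ≤ C) (ht : 1 ≤ t) :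
    stepSize d L t * (ε + C * ∑ i, 1 / coeff lam β (stepSize d L) t i) +
        ∑ i, lam i * (2 * (stepSize d L t * d i * L) ^ 2) ≤
      stepSize d L 1 * ε + (C * (∑ i, lam i) / β + (∑ i, lam i) / 2) / t := by
  have h2 : (0 : ℝ) < t := by exact_mod_cast ht
  have hη := stepSize_pos hn hL ht
  have hΛ : 0 ≤ ∑ i, lam i := Finset.sum_nonneg fun i _ => (hlam i).le
  have h1 : stepSize d L t * ε ≤ stepSize d L 1 * ε :=
    mul_le_mul_of_nonneg_right (stepSize_le hn hL le_rfl ht) hε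
  -- The step size cancels against the one in the coefficients, leaving `1/(t+1)`.
  have h3 : stepSize d L t * (C * ∑ i, 1 / coeff lam β (stepSize d L) t i) ≤
      C * (∑ i, lam i) / β / t := by
    rw [sum_inv_coeff]
    have e : stepSize d L t * (C * ((∑ i, lam i) / (stepSize d L t * β * (t + 1)))) =
        C * (∑ i, lam i) / β / (t + 1) := by field_simp
    rw [e]
    gcongr
    linarith
  have h4 : ∑ i, lam i * (2 * (stepSize d L t * d i * L) ^ 2) ≤ (∑ i, lam i) / 2 / t := by
    rw [Finset.sum_div, Finset.sum_div]
    refine Finset.sum_le_sum fun i _ => ?_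
    have h5 := stepSize_mul_le hn hL ht i
    have h6 : (stepSize d L t * d i * L) ^ 2 ≤ (1 / (2 * √t)) ^ 2 := by gcongr
    have e : (1 / (2 * √(t : ℝ))) ^ 2 = 1 / (4 * t) := by
      rw [div_pow, mul_pow, Real.sq_sqrt h2.le]; norm_num
    rw [e] at h6
    calc lam i * (2 * (stepSize d L t * d i * L) ^ 2) ≤ lam i * (2 * (1 / (4 * t))) := by
          have := (hlam i).le; gcongr
      _ = lam i / 2 / t := by field_simp; norm_num
  rw [mul_add, add_div]
  linarith

variable {G : SmoothConcaveGame N d} {R : (i : Fin N) → E (d i) → ℝ} {ν : Fin N → ℝ}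

/-- The point of the segment from the equilibrium to the first pivot that serves as comparator
over the horizon `T`. -/
def comparator (G : SmoothConcaveGame N d) (R : (i : Fin N) → E (d i) → ℝ) (xstar : Profile d)
    (T : ℕ) : Profile d := fun i =>
  argminOn (interior (G.X i)) (R i) +
    (1 - 1 / (T : ℝ)) • (xstar i - argminOn (interior (G.X i)) (R i))

theorem one_sub_inv_mem {T : ℕ} (hT : 2 ≤ T) : 1 - 1 / (T : ℝ) ∈ Set.Ico (0 : ℝ) 1 := by
  have h : (2 : ℝ) ≤ T := by exact_mod_cast hT
  have h1 : 1 / (T : ℝ) ≤ 1 := (div_le_one (by linarith)).2 (by linarith)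
  have h2 : 0 < 1 / (T : ℝ) := by positivity
  exact ⟨by linarith, by linarith⟩

theorem comparator_mem (hint : ∀ i, (interior (G.X i)).Nonempty)
    (hR : ∀ i, IsSelfConcordantBarrier (G.X i) (ν i) (R i)) {xstar : Profile d}
    (hx : xstar ∈ G.actions) {T : ℕ} (hT : 2 ≤ T) :
    comparator G R xstar T ∈ G.interiorActions := by
  rw [SmoothConcaveGame.mem_interiorActions]
  intro i
  have h1 := ((hR i).argminOn_spec (G.compact_X i) (hint i)).1
  have hs := one_sub_inv_mem hT
  have := (G.convex_X i).add_smul_sub_mem_interior (SmoothConcaveGame.mem_actions.1 hx i) h1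
    (t := 1 / (T : ℝ)) ⟨by linarith [hs.2], by linarith [hs.1]⟩
  convert this using 1
  unfold comparator
  module

theorem norm_comparator_sub_le (hint : ∀ i, (interior (G.X i)).Nonempty)
    (hR : ∀ i, IsSelfConcordantBarrier (G.X i) (ν i) (R i)) {xstar : Profile d}
    (hx : xstar ∈ G.actions) {M : ℝ} (hM : ∀ i, ∀ a ∈ G.X i, ∀ b ∈ G.X i, ‖a - b‖ ≤ M)
    (T : ℕ) (i : Fin N) : ‖comparator G R xstar T i - xstar i‖ ≤ M / T := by
  have h1 := ((hR i).argminOn_spec (G.compact_X i) (hint i)).1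
  have e : comparator G R xstar T i - xstar i =
      (1 / (T : ℝ)) • (argminOn (interior (G.X i)) (R i) - xstar i) := by
    unfold comparator; module
  rw [e, norm_smul, Real.norm_of_nonneg (by positivity), one_div_mul_eq_div]
  have := hM i _ (interior_subset h1) _ (SmoothConcaveGame.mem_actions.1 hx i)
  gcongr

/-- The first pivot minimizes the barrier, so its gradient vanishes there and the divergence is a
plain difference of barrier values. Logarithmic growth with `1 - s = 1/T` then gives `log T`. -/
theorem sum_bregman_comparator_le (hint : ∀ i, (interior (G.X i)).Nonempty)
    (hR : ∀ i, IsSelfConcordantBarrier (G.X i) (ν i) (R i)) (hlam : ∀ i, 0 < lam i)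
    {xstar : Profile d} (hx : xstar ∈ G.actions) {T : ℕ} (hT : 2 ≤ T) :
    ∑ i, lam i * bregman (R i) (comparator G R xstar T i) (argminOn (interior (G.X i)) (R i)) ≤
      (∑ i, lam i * (max (ν i) 0 + 1)) * Real.log T := by
  rw [Finset.sum_mul]
  refine Finset.sum_le_sum fun i _ => ?_
  rw [mul_assoc]
  refine mul_le_mul_of_nonneg_left ?_ (hlam i).le
  have h1 := ((hR i).argminOn_spec (G.compact_X i) (hint i)).1
  have h2 := (hR i).sub_le_log (G.convex_X i) h1 (SmoothConcaveGame.mem_actions.1 hx i)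
    (one_sub_inv_mem hT)
  rw [bregman, (hR i).gradient_argminOn (G.compact_X i) (hint i), inner_zero_left, sub_zero]
  refine h2.trans_eq ?_
  rw [sub_sub_cancel, one_div, Real.log_inv]
  ring

section Random

variable {Ω : Type*} [MeasurableSpace Ω] {P : Measure Ω} [IsProbabilityMeasure P]
  {z : ℕ → (i : Fin N) → Ω → Metric.sphere (0 : E (d i)) 1}

/-- The mean squared distance of the pivot from the comparator. -/
theorem integral_sqDist_pivot_le (hd : ∀ i, 1 ≤ d i) (hn : 0 < ∑ i, d i)
    (hint : ∀ i, (interior (G.X i)).Nonempty)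
    (hmono : G.IsStronglyMonotone lam β) (hL0 : 0 < L)
    (hL : ∀ i, ∀ x ∈ G.actions, |G.u i x| ≤ L)
    (hR : ∀ i, IsSelfConcordantBarrier (G.X i) (ν i) (R i))
    {xstar : Profile d} (hstar : G.IsNash xstar)
    {ℓ : Fin N → ℝ} (hℓ0 : ∀ i, 0 ≤ ℓ i)
    (hℓ : ∀ i, ∀ x ∈ G.actions, ∀ x' ∈ G.actions, ‖G.v i x - G.v i x'‖ ≤ ℓ i * √(sqDist x x'))
    {M : ℝ} (hM0 : 0 ≤ M) (hM : ∀ i, ∀ a ∈ G.X i, ∀ b ∈ G.X i, ‖a - b‖ ≤ M)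
    (hz : ∀ t, 1 ≤ t → ∀ i, Measurable (z t i) ∧ P.map (z t i) = sphereUniform (d i))
    (hind : iIndepFun (fun (p : {t : ℕ // 1 ≤ t} × Fin N) => z p.1 p.2) P)
    {T : ℕ} (hT : 2 ≤ T) :
    ∫ ω, sqDist (pivot G R lam β (stepSize d L) (fun t i => (z t i ω : E (d i))) T)
        (comparator G R xstar T) ∂P ≤
      4 * (∑ i, d i : ℕ) * L / β *
      ((∑ i, lam i * (max (ν i) 0 + 1)) * Real.log T + stepSize d L 1 * β / 2 * (N * M ^ 2) +
        stepSize d L 1 * ((∑ i, lam i * (ℓ i * √N * M + ‖G.v i xstar‖)) * M) +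
        ((∑ i, (lam i * ℓ i) ^ 2) / (2 * β) * (∑ i, lam i) / β + (∑ i, lam i) / 2) *
          (1 + Real.log T)) / √T := by
  obtain ⟨hβ, hlam, -⟩ := id hmono
  have hn' : (0 : ℝ) < (∑ i, d i : ℕ) := by exact_mod_cast hn
  have hT0 : (0 : ℝ) < T := by exact_mod_cast (by omega : 0 < T)
  have hc : ∀ t, 1 ≤ t → ∀ i, 0 < coeff lam β (stepSize d L) t i :=
    fun t ht i => coeff_pos hn hL0 hβ hlam ht i
  set p := comparator G R xstar T with hp
  have hpi : p ∈ G.interiorActions := comparator_mem hint hR hstar.1 hT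
  have hpa := SmoothConcaveGame.interiorActions_subset hpi
  set D := ∑ i, lam i * (ℓ i * √N * M + ‖G.v i xstar‖) with hD
  have hD0 : 0 ≤ D := Finset.sum_nonneg fun i _ => mul_nonneg (hlam i).le
    (add_nonneg (mul_nonneg (mul_nonneg (hℓ0 i) (Real.sqrt_nonneg _)) hM0) (norm_nonneg _))
  have hε : ∀ x ∈ G.actions, ∑ i, lam i * inner ℝ (G.v i p) (x i - p i) ≤ D * (M / T) :=
    fun x hx => hstar.sum_inner_v_le hlam hℓ0 hℓ hM (by positivity) hpa
      (norm_comparator_sub_le hint hR hstar.1 hM T) hx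
  set b := fun t => ∫ ω, ∑ i, lam i * bregman (R i) (p i)
    (pivot G R lam β (stepSize d L) (fun t i => (z t i ω : E (d i))) t i) ∂P with hb
  set a := fun t => ∫ ω, sqDist
    (pivot G R lam β (stepSize d L) (fun t i => (z t i ω : E (d i))) t) p ∂P with ha
  have ha0 : ∀ t, 0 ≤ a t := fun t => integral_nonneg fun ω => sqDist_nonneg _ _
  set C := (∑ i, (lam i * ℓ i) ^ 2) / (2 * β) * (∑ i, lam i) / β + (∑ i, lam i) / 2 with hC
  have hΛ : 0 ≤ ∑ i, lam i := Finset.sum_nonneg fun i _ => (hlam i).le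
  have hC2 : 0 ≤ (∑ i, (lam i * ℓ i) ^ 2) / (2 * β) :=
    div_nonneg (Finset.sum_nonneg fun i _ => sq_nonneg _) (by positivity)
  have hC0 : 0 ≤ C := by positivity
  have hη1 := (stepSize_pos (d := d) hn hL0 le_rfl).le
  have hrec : ∀ t, 1 ≤ t →
      b (t + 1) + stepSize d L (t + 1) * β * (t + 1 : ℕ) / 2 * a (t + 1) ≤
      b t + stepSize d L t * β * t / 2 * a t + (stepSize d L 1 * (D * (M / T)) + C / t) := by
    intro t ht
    have ht0 : (1 : ℝ) ≤ t := by exact_mod_cast ht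
    have h1 := integral_potential_succ_le hd hint hmono hL hR hc ht (stepSize_pos hn hL0 ht).le
      (fun i => (stepSize_mul_le hn hL0 ht i).trans (by
        have : 1 ≤ √(t : ℝ) := Real.one_le_sqrt.2 ht0
        rw [one_div_le_one_div (by positivity) (by norm_num)]
        linarith)) hz hind hℓ0 hℓ hpa hε
    have h2 := error_le hn hL0 hβ hlam (ε := D * (M / T)) (by positivity) hC2 ht
    -- Passing from `η_t` to `η_{t+1}` in the weight only lowers the potential, since the steps
    -- decrease.
    have h3 : stepSize d L (t + 1) * β * (t + 1 : ℕ) / 2 * a (t + 1) ≤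
        stepSize d L t * β * (t + 1) / 2 * a (t + 1) := by
      have := stepSize_le hn hL0 ht (Nat.le_succ t)
      have := ha0 (t + 1)
      push_cast
      gcongr
    change b (t + 1) + _ * a (t + 1) ≤ b t + _ * a t + _ at h1
    linarith
  have hV := le_add_log_of_succ_le
    (V := fun t => b t + stepSize d L t * β * t / 2 * a t) (by positivity) hC0 hrec hT
  have hb1 : b 1 ≤ (∑ i, lam i * (max (ν i) 0 + 1)) * Real.log T := by
    have := sum_bregman_comparator_le hint hR hlam hstar.1 hT
    simpa [hb, pivot] using this
  have ha1 : a 1 ≤ N * M ^ 2 := by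
    have := SmoothConcaveGame.sqDist_le hM (SmoothConcaveGame.interiorActions_subset
      (pivot_one_mem (lam := lam) (β := β) (η := stepSize d L) hR hint fun _ _ => 0)) hpa
    simpa [ha, pivot] using this
  -- The divergence part of the final potential can be dropped because the comparator is interior;
  -- this is one reason not to compare with `x⋆` directly.
  have hbT : 0 ≤ b T := integral_nonneg fun ω => sum_bregman_nonneg hR hlam hpi
    (pivot_mem hR hint hc (by omega) fun t i => norm_eq_of_mem_sphere _)
  have hηT : stepSize d L T * β * T / 2 = β * √T / (4 * (∑ i, d i : ℕ) * L) := by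
    have := stepSize_mul_self d L T
    calc stepSize d L T * β * T / 2 = β / 2 * (stepSize d L T * T) := by ring
      _ = β / 2 * (√T / (2 * (∑ i, d i : ℕ) * L)) := by rw [this]
      _ = _ := by field_simp; norm_num
  have hTA : (T : ℝ) * (stepSize d L 1 * (D * (M / T))) = stepSize d L 1 * (D * M) := by
    field_simp
  have ha1' : stepSize d L 1 * β * (1 : ℕ) / 2 * a 1 ≤ stepSize d L 1 * β / 2 * (N * M ^ 2) := by
    rw [Nat.cast_one, mul_one]
    gcongr
  rw [hηT, hTA] at hV
  have hfin : β * √T / (4 * (∑ i, d i : ℕ) * L) * a T ≤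
      (∑ i, lam i * (max (ν i) 0 + 1)) * Real.log T + stepSize d L 1 * β / 2 * (N * M ^ 2) +
        stepSize d L 1 * (D * M) + C * (1 + Real.log T) := by linarith
  have hsT : 0 < √(T : ℝ) := Real.sqrt_pos.2 hT0
  change a T ≤ _
  rw [le_div_iff₀ hsT]
  calc a T * √T = 4 * (∑ i, d i : ℕ) * L / β *
        (β * √T / (4 * (∑ i, d i : ℕ) * L) * a T) := by field_simp
    _ ≤ _ := mul_le_mul_of_nonneg_left hfin (by positivity)

end Random

/-- Convergence in mean square, for a game with at least one player. -/
theorem exists_integral_sqDist_played_le (hd : ∀ i, 1 ≤ d i) (hn : 0 < ∑ i, d i)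
    (hint : ∀ i, (interior (G.X i)).Nonempty)
    (hmono : G.IsStronglyMonotone lam β) (hL0 : 0 < L)
    (hL : ∀ i, ∀ x ∈ G.actions, |G.u i x| ≤ L)
    (hR : ∀ i, IsSelfConcordantBarrier (G.X i) (ν i) (R i))
    {xstar : Profile d} (hstar : G.IsNash xstar) :
    ∃ C : ℝ, ∀ (Ω : Type*) [MeasurableSpace Ω] (P : Measure Ω) [IsProbabilityMeasure P]
      (z : ℕ → (i : Fin N) → Ω → Metric.sphere (0 : E (d i)) 1),
      (∀ t, 1 ≤ t → ∀ i, Measurable (z t i) ∧ P.map (z t i) = sphereUniform (d i)) →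
      iIndepFun (fun (p : {t : ℕ // 1 ≤ t} × Fin N) => z p.1 p.2) P →
      ∀ T : ℕ, 2 ≤ T →
        Integrable (fun ω => sqDist (played G R lam β (stepSize d L)
          (fun t i => (z t i ω : E (d i))) T) xstar) P ∧
        ∫ ω, sqDist (played G R lam β (stepSize d L)
          (fun t i => (z t i ω : E (d i))) T) xstar ∂P ≤ C * Real.log T / √T := by
  obtain ⟨hβ, hlam, -⟩ := id hmono
  obtain ⟨ℓ, hℓ0, hℓ⟩ := G.exists_lipschitz
  obtain ⟨M, hM0, hM⟩ := G.exists_diameter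
  have hn' : (0 : ℝ) < (∑ i, d i : ℕ) := by exact_mod_cast hn
  have hc : ∀ t, 1 ≤ t → ∀ i, 0 < coeff lam β (stepSize d L) t i :=
    fun t ht i => coeff_pos hn hL0 hβ hlam ht i
  set n : ℝ := ((∑ i, d i : ℕ) : ℝ) with hndef
  set W := ∑ i, lam i * (max (ν i) 0 + 1) with hW
  set D := ∑ i, lam i * (ℓ i * √N * M + ‖G.v i xstar‖) with hD
  set C₀ := (∑ i, (lam i * ℓ i) ^ 2) / (2 * β) * (∑ i, lam i) / β + (∑ i, lam i) / 2 with hC₀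
  set A₀ := stepSize d L 1 * β / 2 * (N * M ^ 2) + stepSize d L 1 * (D * M) + C₀ with hA₀
  set A := 3 * (2 * n * L * (∑ i, lam i) / β + 4 * n * L / β * A₀ + N * M ^ 2) with hA
  have hΛ : 0 ≤ ∑ i, lam i := Finset.sum_nonneg fun i _ => (hlam i).le
  have hD0 : 0 ≤ D := Finset.sum_nonneg fun i _ => mul_nonneg (hlam i).le
    (add_nonneg (mul_nonneg (mul_nonneg (hℓ0 i) (Real.sqrt_nonneg _)) hM0) (norm_nonneg _))
  have hC2 : 0 ≤ (∑ i, (lam i * ℓ i) ^ 2) / (2 * β) :=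
    div_nonneg (Finset.sum_nonneg fun i _ => sq_nonneg _) (by positivity)
  have hη1 := (stepSize_pos (d := d) hn hL0 le_rfl).le
  have hAnn : 0 ≤ A := by positivity
  -- `A` collects the terms of order `1/√T` without a logarithm, absorbed through `log T ≥ log 2`;
  -- the second summand is the coefficient of `log T` itself.
  refine ⟨A / Real.log 2 + 3 * (4 * n * L / β * (W + C₀)), fun Ω _ P _ z hz hind T hT => ?_⟩
  have hT1 : 1 ≤ T := by omega
  have hT2 : (2 : ℝ) ≤ T := by exact_mod_cast hT
  have hT0 : (0 : ℝ) < T := by linarith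
  have hsT : 0 < √(T : ℝ) := Real.sqrt_pos.2 hT0
  have hz1 : ∀ t, 1 ≤ t → ∀ i, Measurable (z t i) := fun t ht i => (hz t ht i).1
  have hI : Integrable (fun ω => sqDist (played G R lam β (stepSize d L)
      (fun t i => (z t i ω : E (d i))) T) xstar) P :=
    integrable_round hR hint hc hT1 hz1
      (H := fun q => sqDist (play R lam β (stepSize d L) T q.1 q.2) xstar)
      ((continuous_sqDist_left xstar).comp_continuousOn (continuousOn_play hR (hc T hT1)))
  refine ⟨hI, ?_⟩
  set p := comparator G R xstar T with hp
  have hJ : Integrable (fun ω => sqDist (pivot G R lam β (stepSize d L)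
      (fun t i => (z t i ω : E (d i))) T) p) P :=
    integrable_pivot hR hint hc hT1 hz1 (continuous_sqDist_left p).continuousOn
  have h1 : ∀ ω, sqDist (played G R lam β (stepSize d L) (fun t i => (z t i ω : E (d i))) T)
      (pivot G R lam β (stepSize d L) (fun t i => (z t i ω : E (d i))) T) ≤
      2 * n * L * (∑ i, lam i) / β / √T := fun ω => by
    have hmem := pivot_mem hR hint hc hT1 (z := fun t i => (z t i ω : E (d i)))
      fun t i => norm_eq_of_mem_sphere _
    have h2 : sqDist (played G R lam β (stepSize d L) (fun t i => (z t i ω : E (d i))) T)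
        (pivot G R lam β (stepSize d L) (fun t i => (z t i ω : E (d i))) T) ≤
        ∑ i, 1 / coeff lam β (stepSize d L) T i :=
      Finset.sum_le_sum fun i _ => norm_play_sub_sq_le hR (hc T hT1) hmem
        (fun i => norm_eq_of_mem_sphere _) i
    rw [sum_inv_coeff] at h2
    refine h2.trans ?_
    have hη := stepSize_pos (d := d) hn hL0 hT1
    have e : 2 * n * L * (∑ i, lam i) / β / √T = (∑ i, lam i) / (stepSize d L T * β * T) := by
      have := stepSize_mul_self d L T
      rw [mul_right_comm (stepSize d L T), this, ← hndef]
      field_simp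
    rw [e]
    gcongr
    linarith
  have h3 : sqDist p xstar ≤ N * M ^ 2 / √T := by
    calc sqDist p xstar ≤ ∑ _i : Fin N, (M / T) ^ 2 := Finset.sum_le_sum fun i _ => by
          have := norm_comparator_sub_le hint hR hstar.1 hM T i
          gcongr
      _ = N * M ^ 2 / (T : ℝ) ^ 2 := by simp; ring
      _ ≤ N * M ^ 2 / √T := by
          gcongr
          rw [Real.sqrt_le_left (by positivity)]
          nlinarith [sq_nonneg ((T : ℝ) ^ 2), mul_self_nonneg ((T : ℝ) - 1), pow_pos hT0 3]
  have h4 := integral_sqDist_pivot_le (P := P) hd hn hint hmono hL0 hL hR hstar hℓ0 hℓ hM0 hM hz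
    hind hT
  have h5 : ∫ ω, sqDist (played G R lam β (stepSize d L)
      (fun t i => (z t i ω : E (d i))) T) xstar ∂P ≤
      ∫ ω, (3 * sqDist (pivot G R lam β (stepSize d L)
        (fun t i => (z t i ω : E (d i))) T) p +
        3 * (2 * n * L * (∑ i, lam i) / β / √T + N * M ^ 2 / √T)) ∂P := by
    refine integral_mono hI ((hJ.const_mul 3).add (integrable_const _)) fun ω => ?_
    -- Split the error into perturbation, distance of the pivot from the comparator, and distance of
    -- the comparator from the equilibrium.
    have h6 := sqDist_le_three_mul
      (played G R lam β (stepSize d L) (fun t i => (z t i ω : E (d i))) T)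
      (pivot G R lam β (stepSize d L) (fun t i => (z t i ω : E (d i))) T) p xstar
    have h7 := h1 ω
    linarith
  rw [integral_add (hJ.const_mul 3) (integrable_const _), integral_const_mul] at h5
  simp only [integral_const, probReal_univ, one_smul] at h5
  refine h5.trans ?_
  have hlog : Real.log 2 ≤ Real.log T := Real.log_le_log (by norm_num) hT2
  have hlog2 : 0 < Real.log 2 := Real.log_pos (by norm_num)
  have hAlog : A ≤ A / Real.log 2 * Real.log T := by
    rw [div_mul_eq_mul_div, le_div_iff₀ hlog2]
    gcongr
  calc _ ≤ 3 * (4 * n * L / β * (W * Real.log T + stepSize d L 1 * β / 2 * (N * M ^ 2) +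
          stepSize d L 1 * (D * M) + C₀ * (1 + Real.log T)) / √T) +
        3 * (2 * n * L * (∑ i, lam i) / β / √T + N * M ^ 2 / √T) := by gcongr
    _ = (A + 3 * (4 * n * L / β * (W + C₀)) * Real.log T) / √T := by
        rw [hA, hA₀]; field_simp; ring
    _ ≤ _ := by
        gcongr
        rw [add_mul]
        linarith

end BanditGame

end

/-! ### The main theorem -/

theorem mainTheorem2 {N : ℕ} {d : Fin N → ℕ} (hd : ∀ i, 1 ≤ d i)
    (G : BanditGame.SmoothConcaveGame N d)
    (hint : ∀ i, (interior (G.X i)).Nonempty)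
    (lam : Fin N → ℝ) (β : ℝ) (hmono : G.IsStronglyMonotone lam β)
    (L : ℝ) (hL : ∀ i, ∀ x ∈ G.actions, |G.u i x| ≤ L)
    (ν : Fin N → ℝ) (R : (i : Fin N) → BanditGame.E (d i) → ℝ)
    (hR : ∀ i, BanditGame.IsSelfConcordantBarrier (G.X i) (ν i) (R i))
    (xstar : BanditGame.Profile d) (hstar : G.IsNash xstar) :
    (∀ y, G.IsNash y → y = xstar) ∧
    ∃ (C : ℝ) (k : ℕ), ∀ (Ω : Type*) [MeasurableSpace Ω] (P : MeasureTheory.Measure Ω)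
      [MeasureTheory.IsProbabilityMeasure P]
      (z : ℕ → (i : Fin N) → Ω → Metric.sphere (0 : BanditGame.E (d i)) 1),
      (∀ t, 1 ≤ t → ∀ i, Measurable (z t i) ∧
        MeasureTheory.Measure.map (z t i) P = BanditGame.sphereUniform (d i)) →
      ProbabilityTheory.iIndepFun (fun (p : {t : ℕ // 1 ≤ t} × Fin N) => z p.1 p.2) P →
      ∀ T : ℕ, 2 ≤ T →
        MeasureTheory.Integrable (fun ω => BanditGame.sqDist (BanditGame.played G R lam β
          (BanditGame.stepSize d L) (fun t i => (z t i ω : BanditGame.E (d i))) T) xstar) P ∧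
        ∫ ω, BanditGame.sqDist (BanditGame.played G R lam β
          (BanditGame.stepSize d L) (fun t i => (z t i ω : BanditGame.E (d i))) T) xstar ∂P
          ≤ C * Real.log T ^ k / √T := by
  refine ⟨fun y hy => hstar.eq hmono hy, ?_⟩
  rcases isEmpty_or_nonempty (Fin N) with hN | ⟨⟨i₀⟩⟩
  -- Without players the squared distance is an empty sum, and positivity of `L` cannot be inferred;
  -- this case is settled directly.
  · refine ⟨0, 0, fun Ω _ P _ z _ _ T _ => ?_⟩
    simp [BanditGame.sqDist]
  · have hn : 0 < ∑ i, d i :=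
      Finset.sum_pos (fun i _ => hd i) ⟨i₀, Finset.mem_univ i₀⟩
    have hL0 := BanditGame.SmoothConcaveGame.payoff_bound_pos hd hint hmono hL i₀
    obtain ⟨C, hC⟩ := BanditGame.exists_integral_sqDist_played_le hd hn hint hmono hL0 hL hR hstar
    -- A single logarithmic factor suffices.
    refine ⟨C, 1, fun Ω _ P _ z hz hind T hT => ?_⟩
    simpa only [pow_one] using hC Ω P z hz hind T hT
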